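/- Conventions: all modules are left modules. For a ring $S$, $K_0(S)$ is the Grothendieck group of finitely generated projective $S$-modules under direct sum, $G_0(S)$ is the abelian group generated by classes $[M]$ of finitely generated $S$-modules with relations $[M]=[L]+[N]$ for every short exact sequence $0\to L\to M\to N\to 0$, and the Cartan homomorphism $K_0(S)\to G_0(S)$ sends $[P]$ to $[P]$. A field $K$ is a splitting field for a finite dimensional $K$-algebra $B$ if $\mathrm{End}_B(S)=K$ for every simple $B$-module $S$. Let $\mathcal O$ be a complete discrete valuation ring with maximal ideal $\mathfrak m$, field of fractions $F$ and residue field $k=\mathcal O/\mathfrak m$. Let $A$ be a finite dimensional (not necessarily semisimple) $F$-algebra and let $R$ be an $\mathcal O$-order in $A$, that is, an $\mathcal O$-subalgebra of $A$ which is finitely generated and free as an $\mathcal O$-module and spans $A$ over $F$. Put $\overline R=R/\mathfrak mR$, a finite dimensional $k$-algebra. An $R$-form of an $A$-module $V$ is an $R$-module $M$ that is finitely generated and free over $\mathcal O$ and satisfies $F\otimes_{\mathcal O}M\cong V$ as $A$-modules. Let $C\colon K_0(A)\to G_0(A)$ and $c\colon K_0(\overline R)\to G_0(\overline R)$ be the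 Cartan homomorphisms. Then: 1. There is a unique homomorphism $e\colon K_0(\overline R)\to K_0(A)$ with $e([P/\mathfrak mP])=[F\otimes_{\mathcal O}P]$ for every finitely generated projective $R$-module $P$. 2. There is a unique homomorphism $d\colon G_0(A)\to G_0(\overline R)$ (the decomposition map) with $d([V])=[M/\mathfrak mM]$ for every finitely generated $A$-module $V$ and every $R$-form $M$ of $V$. 3. The square commutes: $d\circ C\circ e=c$. 4. If $F$ is a splitting field for $A$ and $k$ is a splitting field for $\overline R$, then the pairings $K_0(A)\times G_0(A)\to\mathbb Z$, $\langle [P],[M]\rangle=\dim_F\mathrm{Hom}_A(P,M)$, and $K_0(\overline R)\times G_0(\overline R)\to\mathbb Z$, $\langle [P],[M]\rangle=\dim_k\mathrm{Hom}_{\overline R}(P,M)$, are perfect, and $e$ is adjoint to $d$ with respect to them: $\langle e(x),y\rangle=\langle x,d(y)\rangle$ for all $x\in K_0(\overline R)$ and $y\in G_0(A)$. -/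

import Mathlib

open scoped TensorProduct
open IsLocalRing

namespace BrauerSquare

universe u v w

/-! ### The groups `K₀` and `G₀` of a ring -/

/-- Finitely generated (left) `R`-modules. -/
structure FGMod (R : Type u) [Ring R] : Type (u + 1) where
  carrier : Type u
  [addCommGroup : AddCommGroup carrier]
  [module : Module R carrier]
  [finite : Module.Finite R carrier]

attribute [instance] FGMod.addCommGroup FGMod.module FGMod.finite

/-- Finitely generated projective (left) `R`-modules. -/
structure FGProj (R : Type u) [Ring R] : Type (u + 1) where
  carrier : Type u
  [addCommGroup : AddCommGroup carrier]
  [module : Module R carrier]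
  [finite : Module.Finite R carrier]
  [projective : Module.Projective R carrier]

attribute [instance] FGProj.addCommGroup FGProj.module FGProj.finite FGProj.projective

section Groups

variable (R : Type u) [Ring R]

/-- The relations `[P] = [Q] + [Q']` of `K₀`, one for each isomorphism `P ≅ Q ⊕ Q'`. With
`Q' = 0` they identify isomorphic modules. -/
def K0Rel : Set (FreeAbelianGroup (FGProj R)) :=
  {x | ∃ P Q Q' : FGProj R, Nonempty (P.carrier ≃ₗ[R] (Q.carrier × Q'.carrier)) ∧
    x = FreeAbelianGroup.of P - FreeAbelianGroup.of Q - FreeAbelianGroup.of Q'}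

/-- The relations `[M] = [L] + [N]` of `G₀`, one for each short exact sequence
`0 → L → M → N → 0`. With `N = 0` they identify isomorphic modules. -/
def G0Rel : Set (FreeAbelianGroup (FGMod R)) :=
  {x | ∃ (L M N : FGMod R) (f : L.carrier →ₗ[R] M.carrier) (g : M.carrier →ₗ[R] N.carrier),
    Function.Injective f ∧ Function.Exact f g ∧ Function.Surjective g ∧
    x = FreeAbelianGroup.of M - FreeAbelianGroup.of L - FreeAbelianGroup.of N}

/-- `K₀(R)`: the Grothendieck group of finitely generated projective `R`-modules under direct
sum. -/
def K0 : Type (u + 1) := FreeAbelianGroup (FGProj R) ⧸ AddSubgroup.closure (K0Rel R)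

/-- `G₀(R)`: the Grothendieck group of finitely generated `R`-modules modulo short exact
sequences. -/
def G0 : Type (u + 1) := FreeAbelianGroup (FGMod R) ⧸ AddSubgroup.closure (G0Rel R)

noncomputable instance : AddCommGroup (K0 R) :=
  inferInstanceAs (AddCommGroup (FreeAbelianGroup (FGProj R) ⧸ AddSubgroup.closure (K0Rel R)))

noncomputable instance : AddCommGroup (G0 R) :=
  inferInstanceAs (AddCommGroup (FreeAbelianGroup (FGMod R) ⧸ AddSubgroup.closure (G0Rel R)))

/-- The class `[P]` in `K₀(R)`. -/
noncomputable def K0.mk (P : Type u) [AddCommGroup P] [Module R P] [Module.Finite R P]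
    [Module.Projective R P] : K0 R :=
  QuotientAddGroup.mk' (AddSubgroup.closure (K0Rel R)) (FreeAbelianGroup.of (FGProj.mk P))

/-- The class `[M]` in `G₀(R)`. -/
noncomputable def G0.mk (M : Type u) [AddCommGroup M] [Module R M] [Module.Finite R M] : G0 R :=
  QuotientAddGroup.mk' (AddSubgroup.closure (G0Rel R)) (FreeAbelianGroup.of (FGMod.mk M))

variable {R}

theorem G0.mk_exact {L M N : Type u} [AddCommGroup L] [Module R L] [Module.Finite R L]
    [AddCommGroup M] [Module R M] [Module.Finite R M] [AddCommGroup N] [Module R N]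
    [Module.Finite R N] (f : L →ₗ[R] M) (g : M →ₗ[R] N) (hf : Function.Injective f)
    (hfg : Function.Exact f g) (hg : Function.Surjective g) :
    G0.mk R M = G0.mk R L + G0.mk R N := by
  have h : FreeAbelianGroup.of (FGMod.mk (R := R) M) - FreeAbelianGroup.of (FGMod.mk L) -
      FreeAbelianGroup.of (FGMod.mk N) ∈ AddSubgroup.closure (G0Rel R) :=
    AddSubgroup.subset_closure ⟨FGMod.mk L, FGMod.mk M, FGMod.mk N, f, g, hf, hfg, hg, rfl⟩
  have h' := (QuotientAddGroup.eq_zero_iff _).2 h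
  have h2 : G0.mk R M - G0.mk R L - G0.mk R N = 0 := h'
  rw [sub_sub, sub_eq_zero] at h2
  exact h2

/-- A function on finitely generated projective modules that is additive on direct sums extends
to `K₀`. -/
noncomputable def K0.lift {B : Type*} [AddCommGroup B] (φ : FGProj R → B)
    (hφ : ∀ P Q Q' : FGProj R, Nonempty (P.carrier ≃ₗ[R] (Q.carrier × Q'.carrier)) →
      φ P = φ Q + φ Q') : K0 R →+ B :=
  QuotientAddGroup.lift _ (FreeAbelianGroup.lift φ) <| by
    rw [AddSubgroup.closure_le]
    rintro _ ⟨P, Q, Q', h, rfl⟩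
    simp [AddMonoidHom.mem_ker, hφ P Q Q' h]

/-- A function on finitely generated modules that is additive on short exact sequences extends
to `G₀`. -/
noncomputable def G0.lift {B : Type*} [AddCommGroup B] (φ : FGMod R → B)
    (hφ : ∀ (L M N : FGMod R) (f : L.carrier →ₗ[R] M.carrier) (g : M.carrier →ₗ[R] N.carrier),
      Function.Injective f → Function.Exact f g → Function.Surjective g →
      φ M = φ L + φ N) : G0 R →+ B :=
  QuotientAddGroup.lift _ (FreeAbelianGroup.lift φ) <| by
    rw [AddSubgroup.closure_le]
    rintro _ ⟨L, M, N, f, g, hf, hfg, hg, rfl⟩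
    simp [AddMonoidHom.mem_ker, hφ L M N f g hf hfg hg]

theorem K0.lift_mk {B : Type*} [AddCommGroup B] (φ : FGProj R → B)
    (hφ : ∀ P Q Q' : FGProj R, Nonempty (P.carrier ≃ₗ[R] (Q.carrier × Q'.carrier)) →
      φ P = φ Q + φ Q') (P : Type u) [AddCommGroup P] [Module R P] [Module.Finite R P]
    [Module.Projective R P] : K0.lift φ hφ (K0.mk R P) = φ (FGProj.mk P) :=
  FreeAbelianGroup.lift_apply_of _ _

theorem G0.lift_mk {B : Type*} [AddCommGroup B] (φ : FGMod R → B)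
    (hφ : ∀ (L M N : FGMod R) (f : L.carrier →ₗ[R] M.carrier) (g : M.carrier →ₗ[R] N.carrier),
      Function.Injective f → Function.Exact f g → Function.Surjective g →
      φ M = φ L + φ N) (M : Type u) [AddCommGroup M] [Module R M] [Module.Finite R M] :
    G0.lift φ hφ (G0.mk R M) = φ (FGMod.mk M) :=
  FreeAbelianGroup.lift_apply_of _ _

theorem G0.hom_ext {B : Type*} [AddCommGroup B] {α β : G0 R →+ B}
    (h : ∀ M : FGMod R, α (G0.mk R M.carrier) = β (G0.mk R M.carrier)) : α = β :=
  QuotientAddGroup.addMonoidHom_ext _ (FreeAbelianGroup.lift_ext _ _ h)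

variable (R)

/-- The Cartan homomorphism `K₀(R) → G₀(R)`, `[P] ↦ [P]`. -/
noncomputable def cartan : K0 R →+ G0 R :=
  K0.lift (fun P => G0.mk R P.carrier) <| by
    rintro P Q Q' ⟨φ⟩
    refine G0.mk_exact (φ.symm.toLinearMap ∘ₗ LinearMap.inl R _ _)
      (LinearMap.snd R _ _ ∘ₗ φ.toLinearMap) ?_ ?_ ?_
    · exact φ.symm.injective.comp (LinearMap.inl_injective (R := R))
    · intro x
      constructor
      · intro hx
        refine ⟨(φ x).1, φ.injective ?_⟩
        have hx' : (φ x).2 = 0 := hx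
        ext <;> simp [hx']
      · rintro ⟨y, rfl⟩
        simp
    · exact (LinearMap.snd_surjective (R := R)).comp φ.surjective

theorem cartan_mk (P : Type u) [AddCommGroup P] [Module R P] [Module.Finite R P]
    [Module.Projective R P] : cartan R (K0.mk R P) = G0.mk R P := by
  exact K0.lift_mk _ _ P

end Groups

/-! ### The Hom pairing of a finite dimensional algebra -/

section Pairing

variable (K : Type v) [Field K] (A : Type u) [Ring A] [Algebra K A]

/-- `dim_K Hom_A(P, M)`, where `K` acts on `M` through `K → A`. -/
noncomputable def homDim (P M : Type u) [AddCommGroup P] [Module A P] [AddCommGroup M]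
    [Module A M] : ℕ :=
  letI : Module K M := Module.compHom M (algebraMap K A)
  haveI : IsScalarTower K A M :=
    ⟨fun c a m => by
      rw [Algebra.smul_def, mul_smul]
      rfl⟩
  Module.finrank K (P →ₗ[A] M)

variable {A} in
theorem homDim_eq (P M : Type u) [AddCommGroup P] [Module A P] [AddCommGroup M] [Module A M]
    [inst : Module K M] [IsScalarTower K A M] :
    homDim K A P M = Module.finrank K (P →ₗ[A] M) := by
  have h : Module.compHom M (algebraMap K A) = inst := by
    refine Module.ext' _ _ fun c m => ?_
    exact algebraMap_smul A c m
  unfold homDim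
  subst h
  rfl

variable {A} in
theorem finite_hom [Module.Finite K A] (P M : Type u) [AddCommGroup P] [Module A P]
    [Module.Finite A P] [AddCommGroup M] [Module A M] [Module.Finite A M]
    [Module K M] [IsScalarTower K A M] : Module.Finite K (P →ₗ[A] M) := by
  let : Module K P := Module.compHom P (algebraMap K A)
  have : IsScalarTower K A P :=
    ⟨fun c a m => by
      rw [Algebra.smul_def, mul_smul]
      rfl⟩
  have : Module.Finite K P := Module.Finite.trans A P
  have : Module.Finite K M := Module.Finite.trans A M
  exact Module.Finite.of_injective (LinearMap.restrictScalarsₗ K A P M K)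
    (LinearMap.restrictScalars_injective K)

variable {A} in
theorem homDim_prod [Module.Finite K A] (P Q Q' M : Type u) [AddCommGroup P] [Module A P]
    [AddCommGroup Q] [Module A Q] [Module.Finite A Q]
    [AddCommGroup Q'] [Module A Q'] [Module.Finite A Q']
    [AddCommGroup M] [Module A M] [Module.Finite A M] (φ : P ≃ₗ[A] (Q × Q')) :
    homDim K A P M = homDim K A Q M + homDim K A Q' M := by
  let : Module K M := Module.compHom M (algebraMap K A)
  have : IsScalarTower K A M :=
    ⟨fun c a m => by
      rw [Algebra.smul_def, mul_smul]
      rfl⟩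
  have := finite_hom (A := A) K Q M
  have := finite_hom (A := A) K Q' M
  rw [homDim_eq, homDim_eq, homDim_eq, ← Module.finrank_prod]
  let ψ : ((Q × Q') →ₗ[A] M) ≃ₗ[K] (P →ₗ[A] M) :=
    { toFun := fun f => f ∘ₗ φ.toLinearMap
      invFun := fun f => f ∘ₗ φ.symm.toLinearMap
      map_add' := fun f g => rfl
      map_smul' := fun c f => rfl
      left_inv := fun f => by ext <;> simp
      right_inv := fun f => by ext; simp }
  let χ : ((Q →ₗ[A] M) × (Q' →ₗ[A] M)) ≃ₗ[K] ((Q × Q') →ₗ[A] M) := LinearMap.coprodEquiv K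
  exact (LinearEquiv.finrank_eq (χ.trans ψ)).symm

variable {A} in
theorem homDim_exact [Module.Finite K A] (P L M N : Type u) [AddCommGroup P] [Module A P]
    [Module.Finite A P] [Module.Projective A P] [AddCommGroup L] [Module A L] [Module.Finite A L]
    [AddCommGroup M] [Module A M] [Module.Finite A M]
    [AddCommGroup N] [Module A N] [Module.Finite A N] (f : L →ₗ[A] M) (g : M →ₗ[A] N)
    (hf : Function.Injective f) (hfg : Function.Exact f g) (hg : Function.Surjective g) :
    homDim K A P M = homDim K A P L + homDim K A P N := by
  let iL : Module K L := Module.compHom L (algebraMap K A)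
  let iM : Module K M := Module.compHom M (algebraMap K A)
  let iN : Module K N := Module.compHom N (algebraMap K A)
  have : IsScalarTower K A L := ⟨fun c a m => by rw [Algebra.smul_def, mul_smul]; rfl⟩
  have : IsScalarTower K A M := ⟨fun c a m => by rw [Algebra.smul_def, mul_smul]; rfl⟩
  have : IsScalarTower K A N := ⟨fun c a m => by rw [Algebra.smul_def, mul_smul]; rfl⟩
  have := finite_hom (A := A) K P L
  have := finite_hom (A := A) K P M
  have := finite_hom (A := A) K P N
  rw [homDim_eq, homDim_eq, homDim_eq]
  let F₁ : (P →ₗ[A] L) →ₗ[K] (P →ₗ[A] M) :=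
    { toFun := fun h => f ∘ₗ h
      map_add' := fun h h' => by ext; simp
      map_smul' := fun c h => by
        ext x
        exact f.map_smul (algebraMap K A c) (h x) }
  let F₂ : (P →ₗ[A] M) →ₗ[K] (P →ₗ[A] N) :=
    { toFun := fun h => g ∘ₗ h
      map_add' := fun h h' => by ext; simp
      map_smul' := fun c h => by
        ext x
        exact g.map_smul (algebraMap K A c) (h x) }
  have h₁ : LinearMap.ker F₁ = ⊥ := by
    rw [LinearMap.ker_eq_bot]
    intro a b hab
    ext x
    exact hf (LinearMap.congr_fun hab x)
  have h₂ : LinearMap.range F₂ = ⊤ := by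
    rw [LinearMap.range_eq_top]
    intro a
    exact Module.projective_lifting_property g a hg
  have h₁₂ : LinearMap.range F₁ = LinearMap.ker F₂ := by
    ext h
    constructor
    · rintro ⟨a, rfl⟩
      rw [LinearMap.mem_ker]
      ext x
      exact (hfg _).2 ⟨a x, rfl⟩
    · intro hh
      have hx : ∀ x, h x ∈ LinearMap.range f := fun x =>
        (hfg _).1 (LinearMap.congr_fun (LinearMap.mem_ker.1 hh) x)
      let i := LinearEquiv.ofInjective f hf
      refine ⟨i.symm.toLinearMap ∘ₗ h.codRestrict _ hx, ?_⟩
      ext x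
      have := congrArg Subtype.val (i.apply_symm_apply (h.codRestrict _ hx x))
      exact this
  have e₁ := LinearMap.finrank_range_add_finrank_ker F₁
  have e₂ := LinearMap.finrank_range_add_finrank_ker F₂
  rw [h₁, finrank_bot] at e₁
  rw [h₂, finrank_top, ← h₁₂] at e₂
  omega

/-- The homomorphism `G₀(A) → ℤ`, `[M] ↦ dim_K Hom_A(P, M)`. -/
noncomputable def homDimHom [Module.Finite K A] (P : FGProj A) : G0 A →+ ℤ :=
  G0.lift (fun M : FGMod A => (homDim K A P.carrier M.carrier : ℤ))
    (fun L M N f g hf hfg hg => by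
      exact_mod_cast homDim_exact K P.carrier L.carrier M.carrier N.carrier f g hf hfg hg)

theorem homDimHom_prod [Module.Finite K A] (P Q Q' : FGProj A)
    (h : Nonempty (P.carrier ≃ₗ[A] (Q.carrier × Q'.carrier))) :
    (homDimHom K A P).toIntLinearMap =
      (homDimHom K A Q).toIntLinearMap + (homDimHom K A Q').toIntLinearMap := by
  obtain ⟨φ⟩ := h
  have h' : homDimHom K A P = homDimHom K A Q + homDimHom K A Q' := by
    refine G0.hom_ext fun M => ?_
    rw [AddMonoidHom.add_apply]
    unfold homDimHom
    rw [G0.lift_mk, G0.lift_mk, G0.lift_mk]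
    exact_mod_cast homDim_prod K P.carrier Q.carrier Q'.carrier M.carrier φ
  rw [h']
  rfl

/-- The pairing `K₀(A) × G₀(A) → ℤ`, `⟨[P], [M]⟩ = dim_K Hom_A(P, M)`, of a finite dimensional
`K`-algebra `A`. -/
noncomputable def pairing [Module.Finite K A] : K0 A →ₗ[ℤ] G0 A →ₗ[ℤ] ℤ :=
  (K0.lift (fun P : FGProj A => (homDimHom K A P).toIntLinearMap)
    (homDimHom_prod K A)).toIntLinearMap

theorem pairing_mk [Module.Finite K A] (P M : Type u) [AddCommGroup P] [Module A P]
    [Module.Finite A P] [Module.Projective A P] [AddCommGroup M] [Module A M] [Module.Finite A M]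
    [Module K M] [IsScalarTower K A M] :
    pairing K A (K0.mk A P) (G0.mk A M) = Module.finrank K (P →ₗ[A] M) := by
  rw [← homDim_eq]
  have h : pairing K A (K0.mk A P) = (homDimHom K A (FGProj.mk P)).toIntLinearMap :=
    K0.lift_mk _ (homDimHom_prod K A) P
  rw [h, AddMonoidHom.coe_toIntLinearMap, homDimHom, G0.lift_mk]

/-- `K` is a splitting field for `A`: every endomorphism of a simple `A`-module is
multiplication by an element of `K`. -/
def IsSplittingFieldFor : Prop :=
  ∀ (S : Type u) [AddCommGroup S] [Module A S] [IsSimpleModule A S] (f : S →ₗ[A] S),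
    ∃ c : K, ∀ s : S, f s = algebraMap K A c • s

end Pairing

/-! ### Reduction modulo the maximal ideal -/

section Reduction

variable (O : Type v) [CommRing O] [IsLocalRing O] (R : Type w) [Ring R] [Algebra O R]

/-- The ideal `𝔪R` of `R`. -/
def mIdeal : Ideal R := (maximalIdeal O).map (algebraMap O R)

instance : (mIdeal O R).IsTwoSided := by
  refine ⟨fun {a} b ha => ?_⟩
  unfold mIdeal Ideal.map at *
  induction ha using Submodule.span_induction with
  | mem x hx =>
    obtain ⟨c, hc, rfl⟩ := hx
    rw [show (algebraMap O R) c * b = b * algebraMap O R c from Algebra.commutes c b]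
    exact Ideal.mul_mem_left _ _ (Ideal.subset_span ⟨c, hc, rfl⟩)
  | zero => simp
  | add x y _ _ hx hy =>
    rw [add_mul]
    exact add_mem hx hy
  | smul r x _ hx =>
    rw [smul_eq_mul, mul_assoc]
    exact Ideal.mul_mem_left _ _ hx

/-- The ring `R̄ = R / 𝔪R`. -/
abbrev RBar : Type w := R ⧸ mIdeal O R

/-- The algebra structure of `R̄` over the residue field `k = O / 𝔪`. -/
noncomputable instance : Algebra (ResidueField O) (RBar O R) :=
  Ideal.Quotient.algebraQuotientOfLEComap (p := maximalIdeal O) (P := mIdeal O R)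
    Ideal.le_comap_map

instance [Module.Finite O R] : Module.Finite (ResidueField O) (RBar O R) := by
  let f : R →ₛₗ[residue O] RBar O R :=
    { toFun := Ideal.Quotient.mk _
      map_add' := map_add _
      map_smul' := fun c r => rfl }
  have : RingHomSurjective (residue O) := ⟨residue_surjective⟩
  exact Module.Finite.of_surjective f Ideal.Quotient.mk_surjective

/-- The `R̄`-module `M / 𝔪M`. -/
abbrev Red {R : Type w} [Ring R] [Algebra O R] (M : Type w) [AddCommGroup M] [Module R M] :
    Type w :=
  M ⧸ (mIdeal O R • (⊤ : Submodule R M))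

instance {R : Type w} [Ring R] [Algebra O R] (M : Type w) [AddCommGroup M] [Module R M]
    [Module.Finite R M] : Module.Finite (RBar O R) (Red O (R := R) M) := by
  let f : M →ₛₗ[Ideal.Quotient.mk (mIdeal O R)] Red O (R := R) M :=
    { toFun := Submodule.Quotient.mk
      map_add' := fun _ _ => rfl
      map_smul' := fun _ _ => rfl }
  have : RingHomSurjective (Ideal.Quotient.mk (mIdeal O R)) := ⟨Ideal.Quotient.mk_surjective⟩
  exact Module.Finite.of_surjective f (Submodule.Quotient.mk_surjective _)

instance {R : Type w} [Ring R] [Algebra O R] (M : Type w) [AddCommGroup M] [Module R M]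
    [Module.Projective R M] : Module.Projective (RBar O R) (Red O (R := R) M) := by
  refine Module.Projective.of_lifting_property fun {X Y} _ _ _ _ f g hf => ?_
  let : Module R X := Module.compHom X (Ideal.Quotient.mk (mIdeal O R))
  let : Module R Y := Module.compHom Y (Ideal.Quotient.mk (mIdeal O R))
  let f' : X →ₗ[R] Y :=
    { toFun := f
      map_add' := map_add f
      map_smul' := fun r x => f.map_smul (Ideal.Quotient.mk _ r) x }
  let g' : M →ₗ[R] Y :=
    { toFun := fun m => g (Submodule.Quotient.mk m)
      map_add' := fun x y => g.map_add (Submodule.Quotient.mk x) (Submodule.Quotient.mk y)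
      map_smul' := fun r x => g.map_smul (Ideal.Quotient.mk _ r) (Submodule.Quotient.mk x) }
  obtain ⟨h, hh⟩ := Module.projective_lifting_property f' g' hf
  have hle : mIdeal O R • (⊤ : Submodule R M) ≤ LinearMap.ker h := by
    rw [Submodule.smul_le]
    intro r hr x _
    rw [LinearMap.mem_ker, h.map_smul]
    change Ideal.Quotient.mk (mIdeal O R) r • h x = 0
    rw [Ideal.Quotient.eq_zero_iff_mem.2 hr, zero_smul]
  let k : Red O (R := R) M →ₗ[R] X := Submodule.liftQ _ h hle
  let k' : Red O (R := R) M →ₗ[RBar O R] X :=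
    { toFun := k
      map_add' := map_add k
      map_smul' := fun r x => by
        obtain ⟨r, rfl⟩ := Ideal.Quotient.mk_surjective r
        exact k.map_smul r x }
  refine ⟨k', LinearMap.ext fun x => ?_⟩
  obtain ⟨x, rfl⟩ := Submodule.mkQ_surjective _ x
  have hk : k (Submodule.mkQ _ x) = h x := Submodule.liftQ_apply _ _ _
  change f (k (Submodule.mkQ _ x)) = _
  rw [hk]
  exact LinearMap.congr_fun hh x

end Reduction

/-! ### Scalar extension, the map `e` and the decomposition map `d` -/

section Maps

variable {O : Type u} [CommRing O] (F : Type v) [Field F] [Algebra O F]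
  {A : Type w} [Ring A] [Algebra F A] [Algebra O A] (R : Subalgebra O A)

/-- `V ≅ F ⊗_O M` as `A`-modules, where `M` is an `R`-module and `A = F ⊗_O R` acts on
`F ⊗_O M` by `(x r) (y ⊗ m) = x y ⊗ r m` for `x y : F`, `r : R` and `m : M`. -/
def IsScalarExtension (M : Type w) [AddCommGroup M] [Module R M] [Module O M]
    (V : Type w) [AddCommGroup V] [Module A V] : Prop :=
  ∃ φ : (F ⊗[O] M) ≃+ V, ∀ (x y : F) (r : R) (m : M),
    φ ((x * y) ⊗ₜ[O] (r • m)) = (x • (r : A)) • φ (y ⊗ₜ[O] m)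

/-- The `R`-module `M` is an `R`-form of the `A`-module `V`: it is an `R`-lattice (finitely
generated and free over `O`) and `V ≅ F ⊗_O M`. -/
structure IsForm (M : Type w) [AddCommGroup M] [Module R M] [Module O M]
    (V : Type w) [AddCommGroup V] [Module A V] : Prop where
  finite : Module.Finite O M
  free : Module.Free O M
  ext : IsScalarExtension F R M V

variable [IsLocalRing O]

/-- `e : K₀(R̄) → K₀(A)` satisfies `e [P / 𝔪P] = [F ⊗_O P]` for every finitely generated
projective `R`-module `P`. -/
def IsExtensionMap (e : K0 (RBar O R) →+ K0 A) : Prop :=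
  ∀ (P : Type w) [AddCommGroup P] [Module R P] [Module O P] [IsScalarTower O R P]
    [Module.Finite R P] [Module.Projective R P],
    ∃ V : FGProj A, IsScalarExtension F R P V.carrier ∧
      e (K0.mk (RBar O R) (Red O (R := R) P)) = K0.mk A V.carrier

/-- `d : G₀(A) → G₀(R̄)` satisfies `d [V] = [M / 𝔪M]` for every finitely generated `A`-module `V`
and every `R`-form `M` of `V`. -/
def IsDecompositionMap (d : G0 A →+ G0 (RBar O R)) : Prop :=
  ∀ (V : Type w) [AddCommGroup V] [Module A V] [Module.Finite A V]
    (M : Type w) [AddCommGroup M] [Module R M] [Module O M] [IsScalarTower O R M]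
    [Module.Finite R M], IsForm F R M V →
      d (G0.mk A V) = G0.mk (RBar O R) (Red O (R := R) M)

end Maps

end BrauerSquare

open BrauerSquare

namespace BrauerSquare

universe u v w

/-! ### Calculus of classes in `K0` and `G0` -/

section Classes

variable {R : Type u} [Ring R]

/-! Tensor products are kept at the border of the argument: `F ⊗ M ≅ V` is replaced by an injection
`M → V` whose image contains a nonzero `O`-multiple of every vector (`IsLattice`). Nonzero scalars
of `O` act invertibly on `A`-modules, so an `R`-linear map out of a lattice into an `A`-module
extends uniquely to the ambient module (`IsLattice.exists_extend`).

The map `e` exists because reduction is a bijection on isomorphism classes of finitely generated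
projectives. A projective over `R̄` is the image of an idempotent matrix, and idempotents lift by
Newton iteration, which is where completeness enters (`exists_projective_lift`). Two lifts are
isomorphic by Nakayama (`nonempty_equiv_of_red_equiv`). Hence the classes `[P / 𝔪P]` exhaust the
generators of `K₀(R̄)`, so `e` is unique, and identities of maps on `K₀(R̄)` need only be checked on
them.

The map `d` exists because any two finitely generated lattices in `V` have the same reduction in
`G₀`. For `ϖM ⊆ N ⊆ M` the maps `N → M` and `ϖ : M → N` reduce to a pair in which each kernel is the
other image, so rank and nullity give `[N / ϖN] = [M / ϖM]`; the general case follows by a chain of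
such steps (`G0.mk_red_eq_of_le`). Additivity holds because a lattice in the middle term of an exact
sequence induces lattices in the outer terms, and the quotient lattice is torsion-free.

The square commutes because a projective `P` is itself a lattice in `F ⊗ P`. Adjointness holds
because `Hom_R(P, M)` is free over `O`, localizes to `Hom_A(F ⊗ P, F ⊗ M)` and, as `P` is
projective, reduces to `Hom_R̄(P / 𝔪P, M / 𝔪M)`. Perfectness is duality of bases: projective covers
generate `K₀`, simple modules generate `G₀`, and over a splitting field they pair to the Kronecker
delta. -/

theorem K0.mk_prod {P Q Q' : Type u} [AddCommGroup P] [Module R P] [Module.Finite R P]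
    [Module.Projective R P] [AddCommGroup Q] [Module R Q] [Module.Finite R Q]
    [Module.Projective R Q] [AddCommGroup Q'] [Module R Q'] [Module.Finite R Q']
    [Module.Projective R Q'] (φ : P ≃ₗ[R] (Q × Q')) :
    K0.mk R P = K0.mk R Q + K0.mk R Q' := by
  have h : FreeAbelianGroup.of (FGProj.mk (R := R) P) - FreeAbelianGroup.of (FGProj.mk Q) -
      FreeAbelianGroup.of (FGProj.mk Q') ∈ AddSubgroup.closure (K0Rel R) :=
    AddSubgroup.subset_closure ⟨FGProj.mk P, FGProj.mk Q, FGProj.mk Q', ⟨φ⟩, rfl⟩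
  have h2 : K0.mk R P - K0.mk R Q - K0.mk R Q' = 0 := (QuotientAddGroup.eq_zero_iff _).2 h
  rwa [sub_sub, sub_eq_zero] at h2

theorem K0.mk_eq_zero (P : Type u) [AddCommGroup P] [Module R P] [Module.Finite R P]
    [Module.Projective R P] [Subsingleton P] : K0.mk R P = 0 := by
  have h := K0.mk_prod (R := R) (P := P) (Q := P) (Q' := P) (LinearEquiv.ofSubsingleton _ _)
  simpa using h

theorem K0.mk_congr {P Q : Type u} [AddCommGroup P] [Module R P] [Module.Finite R P]
    [Module.Projective R P] [AddCommGroup Q] [Module R Q] [Module.Finite R Q]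
    [Module.Projective R Q] (φ : P ≃ₗ[R] Q) : K0.mk R P = K0.mk R Q := by
  have h := K0.mk_prod (R := R) (P := P) (Q := Q) (Q' := PUnit.{u + 1})
    (φ.trans (LinearEquiv.prodUnique).symm)
  rwa [K0.mk_eq_zero (R := R) PUnit.{u + 1}, add_zero] at h

theorem K0.hom_ext {B : Type*} [AddCommGroup B] {α β : K0 R →+ B}
    (h : ∀ P : FGProj R, α (K0.mk R P.carrier) = β (K0.mk R P.carrier)) : α = β :=
  QuotientAddGroup.addMonoidHom_ext _ (FreeAbelianGroup.lift_ext _ _ h)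

theorem K0.mem_of_forall_mk {H : Submodule ℤ (K0 R)}
    (h : ∀ P : FGProj R, K0.mk R P.carrier ∈ H) (x : K0 R) : x ∈ H := by
  have : H.mkQ.toAddMonoidHom = 0 :=
    K0.hom_ext fun P => (Submodule.Quotient.mk_eq_zero _).2 (h P)
  exact (Submodule.Quotient.mk_eq_zero _).1 (DFunLike.congr_fun this x)

theorem G0.mem_of_forall_mk {H : Submodule ℤ (G0 R)}
    (h : ∀ M : FGMod R, G0.mk R M.carrier ∈ H) (x : G0 R) : x ∈ H := by
  have : H.mkQ.toAddMonoidHom = 0 :=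
    G0.hom_ext fun M => (Submodule.Quotient.mk_eq_zero _).2 (h M)
  exact (Submodule.Quotient.mk_eq_zero _).1 (DFunLike.congr_fun this x)

theorem G0.mk_eq_zero (M : Type u) [AddCommGroup M] [Module R M] [Module.Finite R M]
    [Subsingleton M] : G0.mk R M = 0 := by
  have h := G0.mk_exact (R := R) (L := M) (M := M) (N := M) LinearMap.id LinearMap.id
    Function.injective_id (fun x => by simp [Subsingleton.elim x 0]) Function.surjective_id
  simpa using h

theorem G0.mk_congr {M N : Type u} [AddCommGroup M] [Module R M] [Module.Finite R M]
    [AddCommGroup N] [Module R N] [Module.Finite R N] (φ : M ≃ₗ[R] N) :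
    G0.mk R M = G0.mk R N := by
  have h := G0.mk_exact (R := R) (L := M) (M := N) (N := PUnit.{u + 1}) φ.toLinearMap 0
    φ.injective (fun x => by simp) (fun x => ⟨0, Subsingleton.elim _ _⟩)
  rw [G0.mk_eq_zero (R := R) PUnit.{u + 1}, add_zero] at h
  exact h.symm

/-- Rank and nullity in `G₀`. -/
theorem G0.mk_eq_ker_add_range [IsNoetherianRing R] {M N : Type u} [AddCommGroup M] [Module R M]
    [Module.Finite R M] [AddCommGroup N] [Module R N] [Module.Finite R N] (f : M →ₗ[R] N) :
    G0.mk R M = G0.mk R (LinearMap.ker f) + G0.mk R (LinearMap.range f) :=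
  G0.mk_exact (LinearMap.ker f).subtype f.rangeRestrict (Submodule.subtype_injective _)
    (fun x => by
      rw [← LinearMap.mem_ker, LinearMap.ker_rangeRestrict]
      simp)
    f.surjective_rangeRestrict

end Classes

/-! ### Projective covers of simple modules -/

section Artinian

variable {B : Type u} [Ring B]

theorem isCompl_ker_range_of_section {M N : Type*} [AddCommGroup M] [Module B M] [AddCommGroup N]
    [Module B N] {g : M →ₗ[B] N} {s : N →ₗ[B] M} (h : g ∘ₗ s = LinearMap.id) :
    IsCompl (LinearMap.ker g) (LinearMap.range s) := by
  have h' : ∀ x, g (s x) = x := LinearMap.congr_fun h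
  refine ⟨Submodule.disjoint_def.2 ?_, codisjoint_iff.2 (Submodule.eq_top_iff'.2 fun x =>
    Submodule.mem_sup.2 ⟨x - s (g x), by simp [h'], s (g x), ⟨_, rfl⟩, by abel⟩)⟩
  rintro _ hx ⟨y, rfl⟩
  rw [LinearMap.mem_ker, h'] at hx
  rw [hx, map_zero]

theorem projective_of_isCompl {M : Type*} [AddCommGroup M] [Module B M] [Module.Projective B M]
    {p q : Submodule B M} (h : IsCompl p q) : Module.Projective B p :=
  Module.Projective.of_split p.subtype (Submodule.projectionOnto p q h)
    (Submodule.projectionOnto_comp_subtype h)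

variable [IsArtinianRing B]

theorem length_submodule_lt {M : Type u} [AddCommGroup M] [Module B M] [Module.Finite B M]
    {N : Submodule B M} (hN : N ≠ ⊤) : Module.length B N < Module.length B M := by
  have : IsFiniteLength B M := isFiniteLength_iff_isNoetherian_isArtinian.2
    ⟨inferInstance, inferInstance⟩
  exact Submodule.length_lt hN

/-- Every simple module over an artinian ring has a projective cover. -/
theorem exists_projective_cover (S : Type u) [AddCommGroup S] [Module B S] [IsSimpleModule B S] :
    ∃ (P : FGProj B) (π : P.carrier →ₗ[B] S), Function.Surjective π ∧
      ∀ N : Submodule B P.carrier, N ⊔ LinearMap.ker π = ⊤ → N = ⊤ := by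
  -- The cover is a finitely generated projective of least length among those mapping onto `S`.
  let X := {P : FGProj B // ∃ π : P.carrier →ₗ[B] S, Function.Surjective π}
  have := IsSimpleModule.nontrivial B S
  obtain ⟨s, hs⟩ := exists_ne (0 : S)
  have hX : Nonempty X := ⟨⟨⟨B⟩, LinearMap.toSpanSingleton B S s,
    IsSimpleModule.toSpanSingleton_surjective B hs⟩⟩
  obtain ⟨⟨P, π, hπ⟩, hmin⟩ : ∃ P : X, ∀ Q : X,
      ¬ Module.length B Q.1.carrier < Module.length B P.1.carrier := by
    have wf : WellFounded fun P Q : X =>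
        Module.length B P.1.carrier < Module.length B Q.1.carrier :=
      InvImage.wf (fun P : X => Module.length B P.1.carrier) wellFounded_lt
    obtain ⟨P, -, hP⟩ := wf.has_min Set.univ ⟨hX.some, trivial⟩
    exact ⟨P, fun Q => hP Q trivial⟩
  refine ⟨P, π, hπ, fun N hN => ?_⟩
  by_contra hNtop
  have hsurj : Function.Surjective (π ∘ₗ N.subtype) := by
    intro t
    obtain ⟨x, rfl⟩ := hπ t
    obtain ⟨y, hy, z, hz, rfl⟩ := Submodule.mem_sup.1 (hN ▸ Submodule.mem_top : x ∈ N ⊔ _)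
    exact ⟨⟨y, hy⟩, by simp [LinearMap.mem_ker.1 hz]⟩
  obtain ⟨f, hf⟩ := Module.projective_lifting_property _ π hsurj
  -- An endomorphism over `S` with image inside `N`. By Fitting's lemma the image of a high power is
  -- a direct summand, hence projective; it still maps onto `S`, and it is shorter than `P` if `N`
  -- is proper.
  let g : Module.End B P.carrier := N.subtype ∘ₗ f
  have hg : ∀ x, π (g x) = π x := fun x => LinearMap.congr_fun hf x
  have hgn : ∀ n x, π ((g ^ n) x) = π x := by
    intro n
    induction n with
    | zero => simp
    | succ n ih =>
      intro x
      rw [pow_succ, Module.End.mul_apply, ih, hg]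
  obtain ⟨n, hn⟩ := Filter.eventually_atTop.1 g.eventually_isCompl_ker_pow_range_pow
  -- The exponent must be positive for the image to lie in `N`; `n` itself may be zero.
  have hc := hn (n + 1) (Nat.le_succ n)
  have : Module.Projective B (LinearMap.range (g ^ (n + 1))) := projective_of_isCompl hc.symm
  refine hmin ⟨⟨LinearMap.range (g ^ (n + 1))⟩, π ∘ₗ Submodule.subtype _, fun t => ?_⟩
    (length_submodule_lt ?_)
  · obtain ⟨x, rfl⟩ := hπ t
    exact ⟨⟨_, LinearMap.mem_range_self _ x⟩, hgn (n + 1) x⟩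
  · intro htop
    refine hNtop (top_le_iff.1 (htop ▸ ?_))
    rintro _ ⟨x, rfl⟩
    rw [pow_succ', Module.End.mul_apply]
    exact (f _).2

/-- A set of classes containing the projective covers of all simple modules generates `K₀`. -/
theorem K0.mk_mem_of_covers (H : Submodule ℤ (K0 B))
    (hH : ∀ (S : Type u) [AddCommGroup S] [Module B S] [IsSimpleModule B S],
      ∃ (P : FGProj B) (π : P.carrier →ₗ[B] S), Function.Surjective π ∧
      (∀ N : Submodule B P.carrier, N ⊔ LinearMap.ker π = ⊤ → N = ⊤) ∧
      K0.mk B P.carrier ∈ H) (n : ℕ∞) :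
    ∀ Q : FGProj B, Module.length B Q.carrier = n → K0.mk B Q.carrier ∈ H := by
  induction n using WellFoundedLT.induction with
  | ind n ih =>
  intro Q hQ
  rcases subsingleton_or_nontrivial Q.carrier with h | h
  · rw [K0.mk_eq_zero]
    exact H.zero_mem
  obtain ⟨m, hm⟩ := IsCoatomic.exists_coatom (α := Submodule B Q.carrier)
  have : IsSimpleModule B (Q.carrier ⧸ m) := isSimpleModule_iff_isCoatom.2 hm
  obtain ⟨P, π, hπ, hN, hP⟩ := hH (Q.carrier ⧸ m)
  obtain ⟨g, hg⟩ := Module.projective_lifting_property π m.mkQ hπ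
  have hgs : Function.Surjective g := by
    -- `range g` and `ker π` span `P`, because `π ∘ g` is onto; superfluity of `ker π` gives `range
    -- g = ⊤`.
    rw [← LinearMap.range_eq_top]
    refine hN _ (top_le_iff.1 fun x _ => ?_)
    obtain ⟨y, hy⟩ := m.mkQ_surjective (π x)
    refine Submodule.mem_sup.2 ⟨g y, LinearMap.mem_range_self _ _, x - g y, ?_, by abel⟩
    have := LinearMap.congr_fun hg y
    rw [LinearMap.mem_ker, map_sub, sub_eq_zero, ← hy]
    exact this.symm
  obtain ⟨s, hs⟩ := Module.projective_lifting_property g LinearMap.id hgs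
  have hc : IsCompl (LinearMap.ker g) (LinearMap.range s) :=
    isCompl_ker_range_of_section hs
  have : Module.Projective B (LinearMap.ker g) := projective_of_isCompl hc
  have e : Q.carrier ≃ₗ[B] LinearMap.ker g × P.carrier :=
    (Submodule.prodEquivOfIsCompl _ _ hc).symm.trans
      (LinearEquiv.prodCongr (LinearEquiv.refl B _)
        (LinearEquiv.ofInjective s (Function.LeftInverse.injective
          (LinearMap.congr_fun hs))).symm)
  rw [K0.mk_prod e]
  refine H.add_mem (ih _ ?_ ⟨LinearMap.ker g⟩ rfl) hP
  rw [← hQ]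
  refine length_submodule_lt fun htop => ?_
  -- The induction needs `ker g` proper: `g = 0` would make the quotient map by the maximal
  -- submodule `m` vanish.
  have h0 : g = 0 := LinearMap.ker_eq_top.1 htop
  refine hm.1 (top_le_iff.1 fun x _ => ?_)
  have := LinearMap.congr_fun hg x
  rw [h0] at this
  rw [← m.ker_mkQ, LinearMap.mem_ker, ← this]
  simp

/-- The classes of simple modules generate `G₀`. -/
theorem G0.mk_mem_of_simple (H : Submodule ℤ (G0 B))
    (hH : ∀ (S : Type u) [AddCommGroup S] [Module B S] [Module.Finite B S] [IsSimpleModule B S],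
      G0.mk B S ∈ H) (n : ℕ∞) :
    ∀ M : FGMod B, Module.length B M.carrier = n → G0.mk B M.carrier ∈ H := by
  induction n using WellFoundedLT.induction with
  | ind n ih =>
  intro M hM
  rcases subsingleton_or_nontrivial M.carrier with h | h
  · rw [G0.mk_eq_zero]
    exact H.zero_mem
  obtain ⟨m, hm⟩ := IsCoatomic.exists_coatom (α := Submodule B M.carrier)
  have : IsSimpleModule B (M.carrier ⧸ m) := isSimpleModule_iff_isCoatom.2 hm
  rw [G0.mk_exact m.subtype m.mkQ m.subtype_injective
    (LinearMap.exact_subtype_mkQ m) m.mkQ_surjective]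
  exact H.add_mem (ih _ (hM ▸ length_submodule_lt hm.1) ⟨m⟩ rfl) (hH _)

end Artinian

/-! ### Perfectness of the Hom pairing -/

/-- Pairing with `b j` reads off the `j`-th coefficient, so generating families that are dual to
each other are automatically bases; no freeness has to be assumed. -/
theorem bijective_of_dual {G H J : Type*} [AddCommGroup G] [AddCommGroup H] [Finite J]
    [DecidableEq J] (p : G →ₗ[ℤ] H →ₗ[ℤ] ℤ) (a : J → G) (b : J → H)
    (ha : Submodule.span ℤ (Set.range a) = ⊤) (hb : Submodule.span ℤ (Set.range b) = ⊤)
    (hab : ∀ i j, p (a i) (b j) = if i = j then 1 else 0) : Function.Bijective p := by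
  have := Fintype.ofFinite J
  constructor
  · rw [injective_iff_map_eq_zero]
    intro x hx
    obtain ⟨c, rfl⟩ := (Submodule.mem_span_range_iff_exists_fun ℤ).1
      (ha ▸ Submodule.mem_top : x ∈ _)
    refine Finset.sum_eq_zero fun j _ => ?_
    have := LinearMap.congr_fun hx (b j)
    simp only [map_sum, map_smul, LinearMap.sum_apply, LinearMap.smul_apply, hab] at this
    simp at this
    simp [this]
  · intro φ
    refine ⟨∑ j, φ (b j) • a j, LinearMap.ext_on_range hb fun j => ?_⟩
    simp [map_sum, LinearMap.sum_apply, hab]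

theorem isPerfPair_of_dual {G H J : Type*} [AddCommGroup G] [AddCommGroup H] [Finite J]
    [DecidableEq J] (p : G →ₗ[ℤ] H →ₗ[ℤ] ℤ) (a : J → G) (b : J → H)
    (ha : Submodule.span ℤ (Set.range a) = ⊤) (hb : Submodule.span ℤ (Set.range b) = ⊤)
    (hab : ∀ i j, p (a i) (b j) = if i = j then 1 else 0) : p.IsPerfPair :=
  ⟨bijective_of_dual p a b ha hb hab, bijective_of_dual p.flip b a hb ha fun i j => by
    rw [LinearMap.flip_apply, hab]
    simp only [eq_comm]⟩

section Perfect

variable (K : Type v) [Field K] (B : Type u) [Ring B] [Algebra K B] [Module.Finite K B]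

/-- The pairing of a projective cover of `S` with a simple module `T` is `1` or `0` according as
`S ≅ T` or not. -/
theorem pairing_cover (hK : IsSplittingFieldFor K B) {P S T : Type u} [AddCommGroup P] [Module B P]
    [Module.Finite B P] [Module.Projective B P] [AddCommGroup S] [Module B S]
    [IsSimpleModule B S] [AddCommGroup T] [Module B T] [IsSimpleModule B T] [Module.Finite B T]
    (π : P →ₗ[B] S)
    (hπ : Function.Surjective π)
    (hN : ∀ N : Submodule B P, N ⊔ LinearMap.ker π = ⊤ → N = ⊤)
    [Decidable (Nonempty (S ≃ₗ[B] T))] :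
    pairing K B (K0.mk B P) (G0.mk B T) = if Nonempty (S ≃ₗ[B] T) then 1 else 0 := by
  let : Module K T := Module.compHom T (algebraMap K B)
  have : IsScalarTower K B T := ⟨fun c a m => by rw [Algebra.smul_def, mul_smul]; rfl⟩
  rw [pairing_mk]
  -- The kernel of a nonzero `f` is maximal. If it did not contain `ker π`, the two would span `P`,
  -- and superfluity of `ker π` would give `ker f = ⊤`. So every map `P → T` factors through `S`,
  -- and Schur's lemma applies.
  have hker : ∀ f : P →ₗ[B] T, f ≠ 0 → LinearMap.ker π ≤ LinearMap.ker f := by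
    intro f hf
    have hfs : Function.Surjective f := LinearMap.surjective_of_ne_zero hf
    have hco : IsCoatom (LinearMap.ker f) := LinearMap.isCoatom_ker_of_surjective hfs
    by_contra hle
    exact hco.1 (hN _ (hco.2 _ (left_lt_sup.2 hle)))
  have hfac : ∀ f : P →ₗ[B] T, ∃ h : S →ₗ[B] T, h ∘ₗ π = f := by
    intro f
    by_cases hf : f = 0
    · exact ⟨0, by simp [hf]⟩
    · let q := π.quotKerEquivOfSurjective hπ
      refine ⟨(LinearMap.ker π).liftQ f (hker f hf) ∘ₗ q.symm.toLinearMap, ?_⟩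
      ext x
      have : q.symm (π x) = (LinearMap.ker π).mkQ x := by
        rw [LinearEquiv.symm_apply_eq]
        rfl
      simp [this]
  split_ifs with hiso
  · obtain ⟨φ⟩ := hiso
    have hne : φ.toLinearMap ∘ₗ π ≠ 0 := by
      intro h0
      have := IsSimpleModule.nontrivial B S
      obtain ⟨s, hs⟩ := exists_ne (0 : S)
      obtain ⟨x, rfl⟩ := hπ s
      exact hs (φ.injective (by simpa using LinearMap.congr_fun h0 x))
    rw [finrank_eq_one (φ.toLinearMap ∘ₗ π) hne, Nat.cast_one]
    intro f
    obtain ⟨h, rfl⟩ := hfac f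
    obtain ⟨c, hc⟩ := hK T (h ∘ₗ φ.symm.toLinearMap)
    refine ⟨c, LinearMap.ext fun x => ?_⟩
    have := hc (φ (π x))
    simp only [LinearMap.comp_apply, LinearEquiv.coe_coe, LinearEquiv.symm_apply_apply] at this
    simp only [LinearMap.smul_apply, LinearMap.comp_apply, LinearEquiv.coe_coe, this]
    rfl
  · have : Subsingleton (P →ₗ[B] T) := by
      refine subsingleton_of_forall_eq 0 fun f => ?_
      obtain ⟨h, rfl⟩ := hfac f
      by_contra h0
      have hh : h ≠ 0 := by
        rintro rfl
        exact h0 (LinearMap.zero_comp _)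
      exact hiso ⟨LinearEquiv.ofBijective h (LinearMap.bijective_of_ne_zero hh)⟩
    rw [Module.finrank_zero_of_subsingleton, Nat.cast_zero]

/-- `Hom_B(B, T) ≅ T` is nonzero. This serves to show that there are finitely many simple modules.
-/
theorem pairing_regular_ne_zero (T : Type u) [AddCommGroup T] [Module B T] [Module.Finite B T]
    [IsSimpleModule B T] : pairing K B (K0.mk B B) (G0.mk B T) ≠ 0 := by
  intro h0
  let : Module K T := Module.compHom T (algebraMap K B)
  have : IsScalarTower K B T := ⟨fun c a m => by rw [Algebra.smul_def, mul_smul]; rfl⟩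
  rw [pairing_mk] at h0
  have := finite_hom (A := B) K B T
  have h1 := Module.finrank_zero_iff.1 (Int.natCast_eq_zero.1 h0)
  have := IsSimpleModule.nontrivial B T
  obtain ⟨s, hs⟩ := exists_ne (0 : T)
  refine hs ?_
  simpa using LinearMap.congr_fun (h1.elim (LinearMap.toSpanSingleton B T s) 0) 1

/-- Over a splitting field the Hom pairing `K₀(B) × G₀(B) → ℤ` is perfect. -/
theorem pairing_isPerfPair (hK : IsSplittingFieldFor K B) : (pairing K B).IsPerfPair := by
  classical
  have : IsArtinianRing B := IsArtinianRing.of_finite K B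
  -- Simple modules are quotients by maximal left ideals, so classes of such ideals index the
  -- isomorphism types by a small set.
  let X := {I : Ideal B // I.IsMaximal}
  let st : Setoid X :=
    { r := fun I I' => Nonempty ((B ⧸ I.1) ≃ₗ[B] (B ⧸ I'.1))
      iseqv := ⟨fun _ => ⟨LinearEquiv.refl B _⟩, fun ⟨φ⟩ => ⟨φ.symm⟩,
        fun ⟨φ⟩ ⟨ψ⟩ => ⟨φ.trans ψ⟩⟩ }
  let J := Quotient st
  let S : J → Type u := fun j => B ⧸ j.out.1
  have hS : ∀ j, IsSimpleModule B (S j) := fun j =>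
    isSimpleModule_iff_isCoatom.2 (Ideal.isMaximal_def.1 j.out.2)
  have hinj : ∀ i j, Nonempty (S i ≃ₗ[B] S j) ↔ i = j := by
    refine fun i j => ⟨fun h => ?_, fun h => h ▸ ⟨LinearEquiv.refl B _⟩⟩
    rw [← Quotient.out_eq i, ← Quotient.out_eq j]
    exact Quotient.sound h
  have hrep : ∀ (T : Type u) [AddCommGroup T] [Module B T] [IsSimpleModule B T],
      ∃ j, Nonempty (S j ≃ₗ[B] T) := by
    intro T _ _ hT
    obtain ⟨I, hI, ⟨φ⟩⟩ := isSimpleModule_iff_quot_maximal.1 hT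
    obtain ⟨ψ⟩ : Nonempty ((B ⧸ (Quotient.mk st ⟨I, hI⟩).out.1) ≃ₗ[B] (B ⧸ I)) :=
      Quotient.mk_out (s := st) ⟨I, hI⟩
    exact ⟨Quotient.mk st ⟨I, hI⟩, ⟨ψ.trans φ.symm⟩⟩
  choose P π hπ hN using fun j => exists_projective_cover (B := B) (S j)
  have hpair : ∀ i j, pairing K B (K0.mk B (P i).carrier) (G0.mk B (S j)) =
      if i = j then 1 else 0 := by
    intro i j
    rw [pairing_cover K B hK (π i) (hπ i) (hN i)]
    simp only [hinj]
  have hPtop : ∀ x, x ∈ Submodule.span ℤ (Set.range fun j => K0.mk B (P j).carrier) := by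
    refine K0.mem_of_forall_mk fun Q => K0.mk_mem_of_covers _ (fun T _ _ _ => ?_) _ Q rfl
    obtain ⟨j, ⟨φ⟩⟩ := hrep T
    refine ⟨P j, φ.toLinearMap ∘ₗ π j, φ.surjective.comp (hπ j), fun N h => hN j N ?_,
      Submodule.subset_span ⟨j, rfl⟩⟩
    rwa [LinearEquiv.ker_comp] at h
  have hStop : ∀ x, x ∈ Submodule.span ℤ (Set.range fun j => G0.mk B (S j)) := by
    refine G0.mem_of_forall_mk fun M => G0.mk_mem_of_simple _ (fun T _ _ _ _ => ?_) _ M rfl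
    obtain ⟨j, ⟨φ⟩⟩ := hrep T
    exact Submodule.subset_span ⟨j, G0.mk_congr φ⟩
  -- `[B]` is a combination of finitely many `[P i]`, and a simple module outside their indices
  -- would pair to zero with it.
  have : Finite J := by
    obtain ⟨c, hc⟩ := Finsupp.mem_span_range_iff_exists_finsupp.1 (hPtop (K0.mk B B))
    refine Set.finite_univ_iff.1 (c.support.finite_toSet.subset fun j _ => ?_)
    by_contra hj
    have h0 : pairing K B (K0.mk B B) (G0.mk B (S j)) = 0 := by
      rw [← hc, Finsupp.sum, map_sum, LinearMap.sum_apply]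
      refine Finset.sum_eq_zero fun i hi => ?_
      rw [map_smul, LinearMap.smul_apply, hpair, if_neg, smul_zero]
      rintro rfl
      exact hj hi
    exact pairing_regular_ne_zero K B (S j) h0
  exact isPerfPair_of_dual _ _ _ (Submodule.eq_top_iff'.2 hPtop) (Submodule.eq_top_iff'.2 hStop)
    hpair

end Perfect

/-! ### Reduction of modules and of homomorphisms -/

section RedFunctor

variable (O : Type v) [CommRing O] [IsLocalRing O] {R : Type w} [Ring R] [Algebra O R]
variable {M N X : Type w} [AddCommGroup M] [Module R M] [AddCommGroup N] [Module R N]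
  [AddCommGroup X] [Module (RBar O R) X]

/-- The reduction map `M → M / 𝔪M`. -/
def Red.mk (M : Type w) [AddCommGroup M] [Module R M] :
    M →ₛₗ[Ideal.Quotient.mk (mIdeal O R)] Red O (R := R) M where
  toFun := Submodule.Quotient.mk
  map_add' _ _ := rfl
  map_smul' _ _ := rfl

theorem Red.mk_surjective : Function.Surjective (Red.mk O (R := R) M) :=
  Submodule.Quotient.mk_surjective _

theorem Red.mk_eq_zero_iff_mem {x : M} :
    Red.mk O (R := R) M x = 0 ↔ x ∈ mIdeal O R • (⊤ : Submodule R M) :=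
  Submodule.Quotient.mk_eq_zero _

variable {O} in
/-- The universal property of `M / 𝔪M`. -/
def Red.lift (f : M →ₛₗ[Ideal.Quotient.mk (mIdeal O R)] X) :
    Red O (R := R) M →ₗ[RBar O R] X where
  toFun := Submodule.liftQ _ f <| by
    rw [Submodule.smul_le]
    intro r hr x _
    rw [LinearMap.mem_ker, map_smulₛₗ, Ideal.Quotient.eq_zero_iff_mem.2 hr, zero_smul]
  map_add' := map_add _
  map_smul' r x := by
    obtain ⟨r, rfl⟩ := Ideal.Quotient.mk_surjective r
    obtain ⟨x, rfl⟩ := Submodule.mkQ_surjective _ x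
    exact map_smulₛₗ f r x

@[simp]
theorem Red.lift_mk (f : M →ₛₗ[Ideal.Quotient.mk (mIdeal O R)] X) (x : M) :
    Red.lift f (Red.mk O M x) = f x := rfl

/-- The reduction of a homomorphism. -/
def Red.map (f : M →ₗ[R] N) : Red O (R := R) M →ₗ[RBar O R] Red O (R := R) N :=
  Red.lift ((Red.mk O N).comp f)

@[simp]
theorem Red.map_mk (f : M →ₗ[R] N) (x : M) : Red.map O f (Red.mk O M x) = Red.mk O N (f x) := rfl

theorem Red.hom_ext {f g : Red O (R := R) M →ₗ[RBar O R] X}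
    (h : ∀ x, f (Red.mk O M x) = g (Red.mk O M x)) : f = g := by
  refine LinearMap.ext fun x => ?_
  obtain ⟨x, rfl⟩ := Red.mk_surjective O x
  exact h x

/-- Isomorphic modules have isomorphic reductions. -/
def Red.congr (φ : M ≃ₗ[R] N) : Red O (R := R) M ≃ₗ[RBar O R] Red O (R := R) N :=
  LinearEquiv.ofLinearMap (Red.map O φ.toLinearMap) (Red.map O φ.symm.toLinearMap)
    (Red.hom_ext O fun x => by simp) (Red.hom_ext O fun x => by simp)

/-- A lift of a homomorphism between reductions along a projective module. -/
theorem Red.exists_lift [Module.Projective R M]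
    (f : Red O (R := R) M →ₗ[RBar O R] Red O (R := R) N) :
    ∃ g : M →ₗ[R] N, Red.map O g = f := by
  let f' : M →ₗ[R] Red O (R := R) N :=
    { toFun := fun x => f (Red.mk O M x)
      map_add' := fun x y => by rw [map_add, map_add]
      map_smul' := fun r x => by
        rw [map_smulₛₗ, map_smul]
        rfl }
  obtain ⟨g, hg⟩ := Module.projective_lifting_property
    (Submodule.mkQ (mIdeal O R • (⊤ : Submodule R N))) f' (Submodule.mkQ_surjective _)
  exact ⟨g, Red.hom_ext O fun x => LinearMap.congr_fun hg x⟩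

end RedFunctor

/-! ### Reduction over a discrete valuation ring -/

section Uniformizer

variable {O : Type v} [CommRing O] [IsDomain O] [IsDiscreteValuationRing O]
  {R : Type w} [Ring R] [Algebra O R] {ϖ : O} (hϖ : Irreducible ϖ)
  {M N : Type w} [AddCommGroup M] [Module R M] [AddCommGroup N] [Module R N]

include hϖ

/-- `𝔪R` is generated by the single central element `ϖ`, so `𝔪M` consists of honest multiples of `ϖ`
rather than sums. -/
theorem mem_mIdeal_smul_top_iff {x : M} :
    x ∈ mIdeal O R • (⊤ : Submodule R M) ↔ ∃ y, x = algebraMap O R ϖ • y := by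
  have hm : mIdeal O R = Ideal.span {algebraMap O R ϖ} := by
    rw [mIdeal, hϖ.maximalIdeal_eq, Ideal.map_span, Set.image_singleton]
  constructor
  · intro hx
    induction hx using Submodule.smul_induction_on' with
    | smul r hr y _ =>
      rw [hm] at hr
      obtain ⟨a, rfl⟩ := Ideal.mem_span_singleton'.1 hr
      exact ⟨a • y, by rw [← mul_smul, Algebra.commutes]⟩
    | add x _ y _ hx hy =>
      obtain ⟨a, rfl⟩ := hx
      obtain ⟨b, rfl⟩ := hy
      exact ⟨a + b, by rw [smul_add]⟩
  · rintro ⟨y, rfl⟩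
    refine Submodule.smul_mem_smul ?_ trivial
    rw [hm]
    exact Ideal.mem_span_singleton_self _

theorem Red.mk_eq_zero_iff {x : M} :
    Red.mk O (R := R) M x = 0 ↔ ∃ y, x = algebraMap O R ϖ • y := by
  rw [Red.mk_eq_zero_iff_mem, mem_mIdeal_smul_top_iff hϖ]

theorem Red.mk_eq_iff {x y : M} :
    Red.mk O (R := R) M x = Red.mk O M y ↔ ∃ z, x - y = algebraMap O R ϖ • z := by
  rw [← sub_eq_zero, ← map_sub, Red.mk_eq_zero_iff hϖ]

/-- Nakayama's lemma for reduction modulo `𝔪`. -/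
theorem surjective_of_surjective_red [Module.Finite O R] [Module.Finite R N] (f : M →ₗ[R] N)
    (hf : Function.Surjective (Red.map O f)) : Function.Surjective f := by
  let : Module O N := Module.compHom N (algebraMap O R)
  have : IsScalarTower O R N := ⟨fun c a m => by rw [Algebra.smul_def, mul_smul]; rfl⟩
  have : Module.Finite O N := Module.Finite.trans R N
  have h : (⊤ : Submodule O N) ≤ (LinearMap.range f).restrictScalars O := by
    refine Submodule.le_of_le_smul_of_le_jacobson_bot (I := maximalIdeal O) Module.Finite.fg_top
      (maximalIdeal_le_jacobson _) fun x _ => ?_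
    obtain ⟨y, hy⟩ := hf (Red.mk O N x)
    obtain ⟨y, rfl⟩ := Red.mk_surjective O y
    rw [Red.map_mk, eq_comm, Red.mk_eq_iff hϖ] at hy
    obtain ⟨z, hz⟩ := hy
    refine Submodule.mem_sup.2 ⟨f y, ⟨y, rfl⟩, ϖ • z, Submodule.smul_mem_smul ?_ trivial, ?_⟩
    · exact (mem_maximalIdeal _).2 hϖ.not_isUnit
    · rw [← algebraMap_smul R ϖ z, ← hz]
      abel
  exact fun x => h (Submodule.mem_top : x ∈ ⊤)

omit hϖ in
/-- A finitely generated projective `R`-module is determined by its reduction. -/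
theorem nonempty_equiv_of_red_equiv [Module.Finite O R] [Module.Finite R M]
    [Module.Projective R M] [Module.Finite R N] [Module.Projective R N]
    (φ : Red O (R := R) M ≃ₗ[RBar O R] Red O (R := R) N) : Nonempty (M ≃ₗ[R] N) := by
  obtain ⟨ϖ, hϖ⟩ := IsDiscreteValuationRing.exists_irreducible O
  have : IsNoetherianRing R := IsNoetherianRing.of_finite O R
  obtain ⟨f, hf⟩ := Red.exists_lift O φ.toLinearMap
  obtain ⟨g, hg⟩ := Red.exists_lift O φ.symm.toLinearMap
  have hfs : Function.Surjective f := surjective_of_surjective_red hϖ f (hf ▸ φ.surjective)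
  have hgs : Function.Surjective g := surjective_of_surjective_red hϖ g (hg ▸ φ.symm.surjective)
  -- Lifts of mutually inverse maps need not be inverse, but their composite is a surjective
  -- endomorphism of a noetherian module.
  have hinj : Function.Injective (g ∘ₗ f) :=
    IsNoetherian.injective_of_surjective_endomorphism _ (hgs.comp hfs)
  exact ⟨LinearEquiv.ofBijective f ⟨Function.Injective.of_comp hinj, hfs⟩⟩

end Uniformizer

/-! ### Lifting idempotents and projective modules -/

section Lifting

variable {O : Type v} [CommRing O] [IsDomain O] [IsDiscreteValuationRing O] {ϖ : O}
  (hϖ : Irreducible ϖ)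

include hϖ

theorem smodEq_pow_iff (x y : O) (n : ℕ) :
    x ≡ y [SMOD (maximalIdeal O ^ n • ⊤ : Submodule O O)] ↔ ϖ ^ n ∣ x - y := by
  rw [SModEq.sub_mem, smul_eq_mul, Ideal.mul_top, hϖ.maximalIdeal_eq, Ideal.span_singleton_pow,
    Ideal.mem_span_singleton]

variable {E : Type*} [AddCommGroup E] [Module O E] [Module.Free O E]

theorem eq_zero_of_forall_pow {x : E} (hx : ∀ n, ∃ c, x = ϖ ^ n • c) : x = 0 := by
  let b := Module.Free.chooseBasis O E
  refine b.repr.injective (Finsupp.ext fun i => ?_)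
  rw [map_zero, Finsupp.zero_apply]
  refine IsHausdorff.haus (inferInstance : IsHausdorff (maximalIdeal O) O) _ fun n => ?_
  rw [smodEq_pow_iff hϖ, sub_zero]
  obtain ⟨c, rfl⟩ := hx n
  exact ⟨b.repr c i, by simp⟩

variable [IsAdicComplete (maximalIdeal O) O]

/-- Completeness of `O` passes to finite free modules by taking limits of coordinates in a basis. -/
theorem exists_limit [Module.Finite O E] (f : ℕ → E)
    (hf : ∀ n, ∃ c, f (n + 1) - f n = ϖ ^ (n + 1) • c) :
    ∃ L, ∀ n, ∃ c, L - f n = ϖ ^ n • c := by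
  let b := Module.Free.chooseBasis O E
  have hcauchy : ∀ m k, ∃ c, f (m + k) - f m = ϖ ^ m • c := by
    intro m k
    induction k with
    | zero => exact ⟨0, by simp⟩
    | succ k ih =>
      obtain ⟨c, hc⟩ := ih
      obtain ⟨c', hc'⟩ := hf (m + k)
      refine ⟨c + ϖ ^ (k + 1) • c', ?_⟩
      rw [smul_add, ← hc, ← mul_smul, ← pow_add, ← add_assoc m k 1, ← hc']
      abel
  have hlim : ∀ i, ∃ l : O, ∀ n, ϖ ^ n ∣ l - b.repr (f n) i := by
    intro i
    obtain ⟨l, hl⟩ := IsPrecomplete.prec (inferInstance : IsPrecomplete (maximalIdeal O) O)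
      (f := fun n => b.repr (f n) i) fun {m n} hmn => by
        obtain ⟨k, rfl⟩ := Nat.exists_eq_add_of_le hmn
        obtain ⟨c, hc⟩ := hcauchy m k
        refine SModEq.symm ((smodEq_pow_iff hϖ _ _ _).2 ⟨b.repr c i, ?_⟩)
        rw [← Finsupp.sub_apply, ← map_sub, hc]
        simp
    exact ⟨l, fun n => (smodEq_pow_iff hϖ _ _ _).1 (hl n).symm⟩
  choose l hl using hlim
  refine ⟨∑ i, l i • b i, fun n => ?_⟩
  choose c hc using fun i => hl i n
  refine ⟨∑ i, c i • b i, b.repr.injective (Finsupp.ext fun i => ?_)⟩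
  rw [map_sub, Finsupp.sub_apply, map_smul, Finsupp.smul_apply, Module.Basis.repr_sum_self,
    Module.Basis.repr_sum_self, hc, smul_eq_mul]

/-- Idempotents lift along the reduction of an algebra that is finite and free over a complete
discrete valuation ring. -/
theorem exists_idempotent_lift {E : Type*} [Ring E] [Algebra O E] [Module.Finite O E]
    [Module.Free O E] (a b : E) (hab : a * a - a = ϖ • b) :
    ∃ x : E, x * x = x ∧ ∃ c, x - a = ϖ • c := by
  -- This is `3a² - 2a³`, the Newton step for `a² - a`. With `t = a² - a`, the new error is `t²(4t -
  -- 3)`.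
  let next : E → E := fun a => a + (a * a - a) * (1 - 2 * a)
  have hnext : ∀ a, next a * next a - next a =
      (a * a - a) * ((a * a - a) * (4 * (a * a - a) - 3)) := by
    intro a
    simp only [next]
    noncomm_ring
  let f : ℕ → E := fun n => next^[n] a
  have hf0 : f 0 = a := rfl
  have hfs : ∀ n, f (n + 1) = next (f n) := fun n => Function.iterate_succ_apply' _ _ _
  have hf : ∀ n, ∃ c, f n * f n - f n = ϖ ^ (n + 1) • c := by
    intro n
    induction n with
    | zero => exact ⟨b, by rw [hf0, hab, zero_add, pow_one]⟩
    | succ n ih =>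
      obtain ⟨c, hc⟩ := ih
      rw [hfs, hnext, hc]
      -- The squared error is divisible by `ϖ ^ (2n + 2)`; one more power than before suffices, and
      -- the surplus `ϖ ^ n` goes into the witness.
      refine ⟨ϖ ^ n • (c * (c * (4 * ϖ ^ (n + 1) • c - 3))), ?_⟩
      rw [smul_mul_assoc, smul_mul_assoc, mul_smul_comm, ← mul_smul, ← mul_smul, ← pow_add,
        ← pow_add]
      congr 2
      ring
  have hcauchy : ∀ n, ∃ c, f (n + 1) - f n = ϖ ^ (n + 1) • c := by
    intro n
    obtain ⟨c, hc⟩ := hf n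
    refine ⟨c * (1 - 2 * f n), ?_⟩
    rw [hfs, ← smul_mul_assoc, ← hc]
    simp only [next]
    abel
  obtain ⟨x, hx⟩ := exists_limit hϖ f hcauchy
  refine ⟨x, sub_eq_zero.1 (eq_zero_of_forall_pow hϖ fun n => ?_), ?_⟩
  · obtain ⟨c, hc⟩ := hx n
    obtain ⟨d, hd⟩ := hf n
    refine ⟨x * c + c * f n - c + ϖ • d, ?_⟩
    have : x * x - x = x * (x - f n) + (x - f n) * f n - (x - f n) + (f n * f n - f n) := by
      noncomm_ring
    rw [this, hc, hd, pow_succ, mul_smul, mul_smul_comm, smul_mul_assoc, ← smul_add, ← smul_sub,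
      ← smul_add]
  -- Split `x - a = (x - f 1) + (f 1 - f 0)`: the limit says nothing about `x - f 0`.
  · obtain ⟨c, hc⟩ := hx 1
    obtain ⟨d, hd⟩ := hcauchy 0
    refine ⟨c + d, ?_⟩
    rw [zero_add, pow_one, hf0] at hd
    rw [pow_one] at hc
    rw [smul_add, ← hc, ← hd]
    abel

omit hϖ in
/-- Finitely generated projective modules lift along `R → R̄`. -/
theorem exists_projective_lift {R : Type w} [Ring R] [Algebra O R] [Module.Finite O R]
    [Module.Free O R] (Q : FGProj (RBar O R)) :
    ∃ P : FGProj R, Nonempty (Red O (R := R) P.carrier ≃ₗ[RBar O R] Q.carrier) := by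
  obtain ⟨ϖ, hϖ⟩ := IsDiscreteValuationRing.exists_irreducible O
  obtain ⟨n, q, hq⟩ := Module.Finite.exists_fin' (RBar O R) Q.carrier
  obtain ⟨s, hs⟩ := Module.projective_lifting_property q LinearMap.id hq
  have hqs : ∀ y, q (s y) = y := LinearMap.congr_fun hs
  let π : (Fin n → R) →ₛₗ[Ideal.Quotient.mk (mIdeal O R)] (Fin n → RBar O R) :=
    { toFun := fun x i => Ideal.Quotient.mk _ (x i)
      map_add' := fun x y => by ext i; simp
      map_smul' := fun r x => by ext i; simp }
  have hπ : Function.Surjective π := fun y =>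
    ⟨fun i => (Ideal.Quotient.mk_surjective (y i)).choose,
      funext fun i => (Ideal.Quotient.mk_surjective (y i)).choose_spec⟩
  have hπ0 : ∀ x, π x = 0 → ∃ y, x = ϖ • y := by
    intro x hx
    have : ∀ i, ∃ y, x i = ϖ • y := by
      intro i
      have h1 : x i ∈ mIdeal O R := Ideal.Quotient.eq_zero_iff_mem.1 (congrFun hx i)
      have h2 : x i ∈ mIdeal O R • (⊤ : Submodule R R) := by
        rwa [smul_eq_mul, Ideal.mul_top]
      obtain ⟨y, hy⟩ := (mem_mIdeal_smul_top_iff hϖ).1 h2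
      exact ⟨y, by rw [hy, algebraMap_smul]⟩
    choose y hy using this
    exact ⟨y, funext hy⟩
  have hπϖ : ∀ y, π (ϖ • y) = 0 := by
    intro y
    have : (ϖ • y : Fin n → R) = algebraMap O R ϖ • y := by rw [algebraMap_smul]
    rw [this, map_smulₛₗ, Ideal.Quotient.eq_zero_iff_mem.2, zero_smul]
    exact Ideal.mem_map_of_mem _ ((mem_maximalIdeal _).2 hϖ.not_isUnit)
  let bs := Pi.basisFun R (Fin n)
  let E := Module.End R (Fin n → R)
  let cE : (Fin n → Fin n → R) ≃ₗ[O] E := bs.constr O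
  have : Module.Finite O E := Module.Finite.equiv cE
  have : Module.Free O E := Module.Free.of_equiv cE
  -- An entrywise lift of the idempotent `s ∘ q` of `R̄ⁿ`, whose image is `Q`; it is idempotent
  -- modulo `ϖ` only.
  let a : E := bs.constr O fun i => (hπ (s (q (π (bs i))))).choose
  have ha : ∀ x, π (a x) = s (q (π x)) := by
    have : π.comp a = (s ∘ₗ q).comp π := bs.ext fun i => by
      simp only [LinearMap.comp_apply, a, Module.Basis.constr_basis]
      exact (hπ (s (q (π (bs i))))).choose_spec
    exact fun x => LinearMap.congr_fun this x
  have hb : ∀ i, ∃ y, (a * a - a) (bs i) = ϖ • y := fun i => hπ0 _ <| by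
    rw [LinearMap.sub_apply, Module.End.mul_apply, map_sub, ha, ha, hqs, sub_self]
  choose b hb using hb
  obtain ⟨x, hx, c, hc⟩ := exists_idempotent_lift hϖ a (bs.constr O b) <| bs.ext fun i => by
    rw [hb, LinearMap.smul_apply, Module.Basis.constr_basis]
  have hxx : ∀ v, x (x v) = x v := fun v => LinearMap.congr_fun hx v
  have hxπ : ∀ v, π (x v) = s (q (π v)) := by
    intro v
    have : x v = a v + ϖ • c v := by
      rw [← LinearMap.smul_apply, ← hc, LinearMap.sub_apply]
      abel
    rw [this, map_add, ha, hπϖ, add_zero]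
  let P := LinearMap.range x
  have hP : Module.Projective R P := Module.Projective.of_split P.subtype x.rangeRestrict <| by
    ext ⟨_, v, rfl⟩ : 2
    exact hxx v
  let f : P →ₛₗ[Ideal.Quotient.mk (mIdeal O R)] Q.carrier := (q.comp π).comp P.subtype
  refine ⟨⟨P⟩, ⟨LinearEquiv.ofBijective (Red.lift f) ⟨?_, ?_⟩⟩⟩
  · rw [injective_iff_map_eq_zero]
    intro v hv
    obtain ⟨⟨_, v, rfl⟩, rfl⟩ := Red.mk_surjective O v
    have hv' : q (π (x v)) = 0 := hv
    have h0 : π (x v) = 0 := by rw [← hxx, hxπ, hv', map_zero]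
    obtain ⟨w, hw⟩ := hπ0 _ h0
    rw [Red.mk_eq_zero_iff hϖ]
    -- `w` need not lie in `P`; applying the idempotent to `x v = ϖ w` gives `x v = ϖ (x w)`.
    refine ⟨⟨x w, w, rfl⟩, Subtype.ext ?_⟩
    change x v = algebraMap O R ϖ • x w
    rw [← hxx, hw, ← algebraMap_smul R ϖ w, map_smul]
  · intro y
    obtain ⟨z, hz⟩ := hπ (s y)
    refine ⟨Red.mk O P ⟨x z, z, rfl⟩, ?_⟩
    change q (π (x z)) = y
    rw [hxπ, hz, hqs, hqs]

end Lifting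

/-! ### Comparing the reductions of two lattices -/

section Central

variable {O : Type v} [CommRing O] {R : Type w} [Ring R] [Algebra O R]
  {M : Type*} [AddCommGroup M] [Module R M]

theorem algebraMap_smul_comm (c : O) (r : R) (x : M) :
    algebraMap O R c • r • x = r • algebraMap O R c • x := by
  rw [← mul_smul, ← mul_smul, Algebra.commutes]

/-- Multiplication by a scalar from `O`, as an `R`-linear map. -/
def scalarMul (R M : Type*) [Ring R] [Algebra O R] [AddCommGroup M] [Module R M] (c : O) :
    M →ₗ[R] M where
  toFun x := algebraMap O R c • x
  map_add' := smul_add _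
  map_smul' r x := algebraMap_smul_comm c r x

@[simp]
theorem scalarMul_apply (c : O) (x : M) : scalarMul R M c x = algebraMap O R c • x := rfl

end Central

section Compare

variable {O : Type v} [CommRing O] [IsDomain O] [IsDiscreteValuationRing O]
  {R : Type w} [Ring R] [Algebra O R] {ϖ : O} (hϖ : Irreducible ϖ)

include hϖ

/-- If `j n = ϖ m = j (h m)`, then `n = h m` by injectivity. Applied in both directions it makes the
reductions of `j` and `h` an exact two-periodic complex. -/
theorem ker_red_map {M N : Type w} [AddCommGroup M] [Module R M] [AddCommGroup N] [Module R N]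
    (j : N →ₗ[R] M) (h : M →ₗ[R] N) (hj : Function.Injective j)
    (hjh : ∀ x, j (h x) = algebraMap O R ϖ • x) :
    LinearMap.ker (Red.map O j) = LinearMap.range (Red.map O h) := by
  ext n
  obtain ⟨n, rfl⟩ := Red.mk_surjective O n
  rw [LinearMap.mem_ker, Red.map_mk, Red.mk_eq_zero_iff hϖ]
  constructor
  · rintro ⟨m, hm⟩
    refine ⟨Red.mk O M m, ?_⟩
    rw [Red.map_mk, hj (hm.trans (hjh m).symm)]
  · rintro ⟨m, hm⟩
    obtain ⟨m, rfl⟩ := Red.mk_surjective O m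
    rw [Red.map_mk, eq_comm, Red.mk_eq_iff hϖ] at hm
    obtain ⟨z, hz⟩ := hm
    refine ⟨m + j z, ?_⟩
    rw [smul_add, ← hjh, ← map_smul, ← hz, ← map_add]
    congr 1
    abel

variable [Module.Finite O R]

/-- If `N → M → N` and `M → N → M` are both multiplication by a uniformizer, then `M` and `N` have
the same reduction in `G₀`. -/
theorem G0.mk_red_eq_of_factor {M N : Type w} [AddCommGroup M] [Module R M] [Module.Finite R M]
    [AddCommGroup N] [Module R N] [Module.Finite R N]
    (j : N →ₗ[R] M) (h : M →ₗ[R] N) (hj : Function.Injective j) (hh : Function.Injective h)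
    (hjh : ∀ x, j (h x) = algebraMap O R ϖ • x) (hhj : ∀ x, h (j x) = algebraMap O R ϖ • x) :
    G0.mk (RBar O R) (Red O (R := R) N) = G0.mk (RBar O R) (Red O (R := R) M) := by
  have : IsNoetherianRing (RBar O R) := IsNoetherianRing.of_finite (ResidueField O) (RBar O R)
  -- Rank and nullity for both reductions; each kernel is the range of the other map, so the two
  -- sums agree up to order.
  rw [G0.mk_eq_ker_add_range (Red.map O j), G0.mk_eq_ker_add_range (Red.map O h),
    G0.mk_congr (LinearEquiv.ofEq _ _ (ker_red_map hϖ j h hj hjh)),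
    G0.mk_congr (LinearEquiv.ofEq _ _ (ker_red_map hϖ h j hh hhj)), add_comm]

theorem G0.mk_red_eq_of_le {V : Type w} [AddCommGroup V] [Module R V]
    (hV : ∀ v : V, algebraMap O R ϖ • v = 0 → v = 0) (n : ℕ) :
    ∀ (M N : Submodule R V) [Module.Finite R M] [Module.Finite R N], N ≤ M →
      (∀ x ∈ M, algebraMap O R (ϖ ^ n) • x ∈ N) →
      G0.mk (RBar O R) (Red O (R := R) N) = G0.mk (RBar O R) (Red O (R := R) M) := by
  have : IsNoetherianRing R := IsNoetherianRing.of_finite O R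
  induction n with
  | zero =>
    intro M N _ _ hle h
    obtain rfl : N = M := le_antisymm hle fun x hx => by simpa using h x hx
    rfl
  | succ n ih =>
    intro M N _ _ hle h
    -- The intermediate lattice `{x ∈ M | ϖ ^ n x ∈ N}`: the step from `N` to `M'` has exponent `n`,
    -- and the step from `M'` to `M` has exponent one.
    let M' : Submodule R V := M ⊓ N.comap (scalarMul R V (ϖ ^ n))
    have hM' : M' ≤ M := inf_le_left
    have : Module.Finite R M' := Module.Finite.of_injective (Submodule.inclusion hM')
      (Submodule.inclusion_injective hM')
    rw [ih M' N (le_inf hle fun x hx => N.smul_mem _ hx) fun x hx => hx.2]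
    have hmem : ∀ x : M, scalarMul R V ϖ x ∈ M' := by
      refine fun x => ⟨M.smul_mem _ x.2, ?_⟩
      change algebraMap O R (ϖ ^ n) • algebraMap O R ϖ • (x : V) ∈ N
      rw [← mul_smul, ← map_mul, ← pow_succ]
      exact h x x.2
    refine G0.mk_red_eq_of_factor hϖ (Submodule.inclusion hM')
      ((scalarMul R V ϖ ∘ₗ M.subtype).codRestrict M' hmem)
      (Submodule.inclusion_injective hM') ?_ (fun _ => rfl) (fun _ => rfl)
    rw [injective_iff_map_eq_zero]
    intro x hx
    exact Subtype.ext (hV _ (congrArg Subtype.val hx))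

end Compare

/-! ### Lattices in modules over the scalar extension -/

section Lattice

variable {O : Type u} [CommRing O] {A : Type w} [Ring A] [Algebra O A] (R : Subalgebra O A)

/-- The `R`-linear map `j : M → V` into an `A`-module identifies `M` with a full lattice. -/
structure IsLattice {M V : Type*} [AddCommGroup M] [Module R M] [AddCommGroup V] [Module A V]
    (j : M →ₗ[R] V) : Prop where
  injective : Function.Injective j
  full : ∀ v, ∃ c : O, c ≠ 0 ∧ ∃ m, algebraMap O R c • v = j m

end Lattice

section Order

variable {O : Type u} [CommRing O] {F : Type v} [Field F]
  [Algebra O F] [IsFractionRing O F] {A : Type w} [Ring A] [Algebra F A] [Algebra O A]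
  [IsScalarTower O F A] {R : Subalgebra O A}

section Torsion

variable {V : Type*} [AddCommGroup V] [Module A V]

omit [Algebra O F] [IsFractionRing O F] [Algebra F A] [IsScalarTower O F A] [Field F] in
theorem algebraMap_smul_smul {c : O} {a : A} {r : R} (h : algebraMap O A c * a = r) (x : V) :
    algebraMap O R c • a • x = r • x := by
  change algebraMap O A c • a • x = (r : A) • x
  rw [← h, mul_smul]

include F

variable (F) in
theorem smul_left_cancel_of_ne_zero {c : O} (hc : c ≠ 0) {v w : V}
    (h : algebraMap O R c • v = algebraMap O R c • w) : v = w := by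
  have h' : algebraMap O A c • v = algebraMap O A c • w := h
  have hu : algebraMap F A (algebraMap O F c)⁻¹ * algebraMap O A c = 1 := by
    rw [IsScalarTower.algebraMap_apply O F A, ← map_mul, inv_mul_cancel₀, map_one]
    exact (map_ne_zero_iff _ (IsFractionRing.injective O F)).2 hc
  rw [← one_smul A v, ← one_smul A w, ← hu, mul_smul, mul_smul, h']

variable (F) in
theorem exists_smul_eq_of_ne_zero {c : O} (hc : c ≠ 0) (v : V) :
    ∃ w : V, algebraMap O R c • w = v := by
  refine ⟨algebraMap F A (algebraMap O F c)⁻¹ • v, ?_⟩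
  change algebraMap O A c • _ = v
  rw [← mul_smul, IsScalarTower.algebraMap_apply O F A, ← map_mul, mul_inv_cancel₀, map_one,
    one_smul]
  exact (map_ne_zero_iff _ (IsFractionRing.injective O F)).2 hc

variable [IsDomain O]

variable (F) in
/-- Every element of `A` has a multiple in the order `R`. -/
theorem exists_smul_mem_order (hR : Submodule.span F (R : Set A) = ⊤) (a : A) :
    ∃ c : O, c ≠ 0 ∧ ∃ r : R, algebraMap O A c * a = r := by
  have ha : a ∈ Submodule.span F (R : Set A) := hR ▸ Submodule.mem_top
  induction ha using Submodule.span_induction with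
  | mem x hx => exact ⟨1, one_ne_zero, ⟨x, hx⟩, by simp⟩
  | zero => exact ⟨1, one_ne_zero, 0, by simp⟩
  | add x y _ _ hx hy =>
    obtain ⟨c, hc, r, hr⟩ := hx
    obtain ⟨d, hd, s, hs⟩ := hy
    refine ⟨c * d, mul_ne_zero hc hd, algebraMap O R d * r + algebraMap O R c * s, ?_⟩
    have e1 : ((algebraMap O R d * r + algebraMap O R c * s : R) : A) =
      algebraMap O A d * r + algebraMap O A c * s := rfl
    rw [e1, ← hr, ← hs, mul_add, map_mul, ← mul_assoc, ← mul_assoc, ← map_mul, ← map_mul,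
      mul_comm d c]
  | smul f x _ hx =>
    obtain ⟨c, hc, r, hr⟩ := hx
    obtain ⟨n, d, hd, rfl⟩ := IsFractionRing.div_surjective (A := O) f
    have hd0 : d ≠ 0 := nonZeroDivisors.ne_zero hd
    have hd' : algebraMap O F d ≠ 0 := (map_ne_zero_iff _ (IsFractionRing.injective O F)).2 hd0
    refine ⟨d * c, mul_ne_zero hd0 hc, algebraMap O R n * r, ?_⟩
    have e1 : ((algebraMap O R n * r : R) : A) = algebraMap O A n * r := rfl
    rw [e1, ← hr, Algebra.smul_def, map_mul, ← mul_assoc, ← mul_assoc, mul_assoc (algebraMap O A d),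
      Algebra.commutes c (algebraMap F A _), ← mul_assoc, IsScalarTower.algebraMap_apply O F A d,
      ← map_mul, mul_div_cancel₀ _ hd', ← IsScalarTower.algebraMap_apply]

end Torsion

namespace IsLattice

variable {M V W : Type*} [AddCommGroup M] [Module R M] [AddCommGroup V] [Module A V]
  [AddCommGroup W] [Module A W]

include F

variable (F) in
theorem hom_ext {j : M →ₗ[R] V} (hj : IsLattice R j) {g g' : V →ₗ[A] W}
    (h : ∀ m, g (j m) = g' (j m)) : g = g' := by
  ext v
  obtain ⟨c, hc, m, hm⟩ := hj.full v
  refine smul_left_cancel_of_ne_zero F (R := R) hc ?_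
  have e : ∀ k : V →ₗ[A] W, algebraMap O R c • k v = k (j m) := fun k => by
    rw [← hm]
    exact (k.map_smul (algebraMap O A c) v).symm
  rw [e, e, h]

variable [IsDomain O]

variable (F) in
/-- An `R`-linear map from a lattice to an `A`-module extends to an `A`-linear map. -/
theorem exists_extend (hR : Submodule.span F (R : Set A) = ⊤) {j : M →ₗ[R] V}
    (hj : IsLattice R j) (f : M →ₗ[R] W) : ∃ g : V →ₗ[A] W, ∀ m, g (j m) = f m := by
  choose c hc m hm using hj.full
  -- The forced value `g v = c⁻¹ f(m)`, where `c v = j m`. The claim `key` says that any other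
  -- denominator gives the same value, from which linearity follows.
  choose g hg using fun v => exists_smul_eq_of_ne_zero F (R := R) (hc v) (f (m v))
  have key : ∀ (v : V) (d : O) (n : M), algebraMap O R d • v = j n →
      algebraMap O R d • g v = f n := by
    intro v d n h
    refine smul_left_cancel_of_ne_zero F (R := R) (hc v) ?_
    rw [algebraMap_smul_comm, hg, ← map_smul, ← map_smul]
    congr 1
    refine hj.injective ?_
    rw [map_smul, map_smul, ← hm, ← h, algebraMap_smul_comm]
  refine ⟨{ toFun := g, map_add' := fun v w => ?_, map_smul' := fun a v => ?_ }, fun n => ?_⟩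
  · refine smul_left_cancel_of_ne_zero F (R := R) (mul_ne_zero (hc v) (hc w)) ?_
    rw [key (v + w) (c v * c w)
      (algebraMap O R (c w) • m v + algebraMap O R (c v) • m w), map_add, map_smul, map_smul,
      ← hg, ← hg, smul_add, map_mul, mul_smul, mul_smul, algebraMap_smul_comm (c w)]
    rw [map_add, map_smul, map_smul, ← hm, ← hm, smul_add, map_mul, mul_smul, mul_smul,
      algebraMap_smul_comm (c w)]
  · obtain ⟨d, hd, r, hr⟩ := exists_smul_mem_order F hR a
    refine smul_left_cancel_of_ne_zero F (R := R) (mul_ne_zero (hc v) hd) ?_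
    rw [key (a • v) (c v * d) (r • m v), map_smul, RingHom.id_apply, map_mul, mul_smul,
      algebraMap_smul_smul hr, algebraMap_smul_comm, hg]
    rw [map_mul, mul_smul, algebraMap_smul_smul hr, map_smul, algebraMap_smul_comm, hm]
  · have := key (j n) 1 n (by simp)
    simpa using this

variable (F) in
theorem nonempty_equiv (hR : Submodule.span F (R : Set A) = ⊤) {j : M →ₗ[R] V}
    (hj : IsLattice R j) {j' : M →ₗ[R] W} (hj' : IsLattice R j') : Nonempty (V ≃ₗ[A] W) := by
  obtain ⟨g, hg⟩ := hj.exists_extend F hR j'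
  obtain ⟨h, hh⟩ := hj'.exists_extend F hR j
  exact ⟨LinearEquiv.ofLinearMap g h (hj'.hom_ext F fun m => by simp [hg, hh])
    (hj.hom_ext F fun m => by simp [hg, hh])⟩

end IsLattice

variable [IsDomain O]

/-- `V ≅ F ⊗ M` as `A`-modules as soon as `M` is a lattice in `V`. -/
theorem IsLattice.isScalarExtension {M V : Type w} [AddCommGroup M] [Module R M] [Module O M]
    [IsScalarTower O R M] [AddCommGroup V] [Module A V] {j : M →ₗ[R] V} (hj : IsLattice R j) :
    IsScalarExtension F R M V := by
  let : Module F V := Module.compHom V (algebraMap F A)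
  let : Module O V := Module.compHom V (algebraMap O A)
  have : IsScalarTower O F V := ⟨fun c a m => by
    change algebraMap F A (c • a) • m = algebraMap O A c • algebraMap F A a • m
    rw [← mul_smul, Algebra.smul_def, map_mul, ← IsScalarTower.algebraMap_apply]⟩
  let jO : M →ₗ[O] V :=
    { toFun := j
      map_add' := map_add j
      map_smul' := fun c m => by
        rw [← algebraMap_smul R c m, map_smul]
        rfl }
  -- A lattice inclusion is a localization at the nonzero scalars, and localization is base change
  -- to the fraction field.
  have hloc : IsLocalizedModule (nonZeroDivisors O) jO := by
    refine ⟨fun c => ?_, fun v => ?_, fun {x y} h => ⟨1, by rw [hj.injective h]⟩⟩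
    · rw [Module.End.isUnit_iff]
      have hc : (c : O) ≠ 0 := nonZeroDivisors.ne_zero c.2
      exact ⟨fun x y h => smul_left_cancel_of_ne_zero F (R := R) hc h, fun v =>
        exists_smul_eq_of_ne_zero F (R := R) hc v⟩
    · obtain ⟨c, hc, m, hm⟩ := hj.full v
      exact ⟨⟨m, ⟨c, mem_nonZeroDivisors_of_ne_zero hc⟩⟩, hm⟩
  have hb : IsBaseChange F jO :=
    (isLocalizedModule_iff_isBaseChange (nonZeroDivisors O) F jO).1 hloc
  refine ⟨hb.equiv.toAddEquiv, fun x y r m => ?_⟩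
  change hb.equiv ((x * y) ⊗ₜ (r • m)) = (x • (r : A)) • hb.equiv (y ⊗ₜ m)
  rw [hb.equiv_tmul, hb.equiv_tmul]
  change algebraMap F A (x * y) • j (r • m) = (x • (r : A)) • algebraMap F A y • j m
  rw [map_smul, ← mul_smul]
  change algebraMap F A (x * y) • (r : A) • j m = _
  rw [← mul_smul, map_mul, Algebra.smul_def, mul_assoc, mul_assoc,
    Algebra.commutes y (r : A)]

/-- If `M` is `O`-free and `V ≅ F ⊗ M`, then `M` is a lattice in `V`. -/
theorem IsScalarExtension.exists_isLattice {M V : Type w} [AddCommGroup M] [Module R M]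
    [Module O M] [IsScalarTower O R M] [Module.Free O M] [AddCommGroup V] [Module A V]
    (h : IsScalarExtension F R M V) : ∃ j : M →ₗ[R] V, IsLattice R j := by
  obtain ⟨φ, hφ⟩ := h
  let ι : M →ₗ[O] F ⊗[O] M := TensorProduct.mk O F M 1
  have hι : IsLocalizedModule (nonZeroDivisors O) ι := inferInstance
  -- `φ` is only additive by hypothesis; `O`-linearity comes from its compatibility formula with `x
  -- = c` and `r = 1`.
  have hφO : ∀ (c : O) (t : F ⊗[O] M), φ (c • t) = algebraMap O R c • φ t := by
    intro c t
    induction t using TensorProduct.induction_on with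
    | zero => simp
    | add x y hx hy => rw [smul_add, map_add, map_add, hx, hy, smul_add]
    | tmul y m =>
      have := hφ (algebraMap O F c) y 1 m
      rw [one_smul, ← Algebra.smul_def, ← TensorProduct.smul_tmul'] at this
      rw [this]
      change _ = algebraMap O A c • φ (y ⊗ₜ m)
      congr 1
      simp [Algebra.algebraMap_eq_smul_one]
  refine ⟨{ toFun := fun m => φ (1 ⊗ₜ m), map_add' := fun x y => ?_, map_smul' := fun r m => ?_ },
    ⟨?_, fun v => ?_⟩⟩
  · rw [TensorProduct.tmul_add, map_add]
  · have := hφ 1 1 r m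
    rw [one_mul, one_smul] at this
    exact this
  · intro x y hxy
    have h1 : ι x = ι y := φ.injective hxy
    obtain ⟨c, hc⟩ := (IsLocalizedModule.eq_iff_exists (nonZeroDivisors O) ι).1 h1
    exact smul_right_injective M (nonZeroDivisors.ne_zero c.2) hc
  · obtain ⟨t, rfl⟩ := φ.surjective v
    obtain ⟨⟨m, c⟩, hc⟩ := IsLocalizedModule.surj (nonZeroDivisors O) ι t
    refine ⟨c, nonZeroDivisors.ne_zero c.2, m, ?_⟩
    rw [← hφO]
    exact congrArg φ hc

end Order

/-! ### The decomposition map -/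

section Decomposition

variable {O : Type u} [CommRing O] [IsDomain O] [IsDiscreteValuationRing O] (F : Type v) [Field F]
  [Algebra O F] [IsFractionRing O F] {A : Type w} [Ring A] [Algebra F A] [Algebra O A]
  [IsScalarTower O F A] {R : Subalgebra O A}

omit [IsDomain O] [IsDiscreteValuationRing O] in
theorem IsLattice.subtype_range {M V : Type*} [AddCommGroup M] [Module R M] [AddCommGroup V]
    [Module A V] {j : M →ₗ[R] V} (hj : IsLattice R j) :
    IsLattice R (LinearMap.range j).subtype := by
  refine ⟨Submodule.subtype_injective _, fun v => ?_⟩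
  obtain ⟨c, hc, m, hm⟩ := hj.full v
  exact ⟨c, hc, ⟨_, m, rfl⟩, hm⟩

/-- A finitely generated submodule is contained in a lattice up to a power of the uniformizer. -/
theorem IsLattice.exists_pow_smul_mem {ϖ : O} (hϖ : Irreducible ϖ) {V : Type*} [AddCommGroup V]
    [Module A V] {M : Submodule R V} (hM : IsLattice R M.subtype) {N : Submodule R V}
    (hN : N.FG) : ∃ n, ∀ x ∈ N, algebraMap O R (ϖ ^ n) • x ∈ M := by
  induction N, hN using Submodule.fg_induction with
  | singleton v =>
    obtain ⟨c, hc, m, hm⟩ := hM.full v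
    obtain ⟨n, u, hu⟩ := IsDiscreteValuationRing.associated_pow_irreducible hc hϖ
    refine ⟨n, fun x hx => ?_⟩
    obtain ⟨r, rfl⟩ := Submodule.mem_span_singleton.1 hx
    rw [← hu, mul_comm, map_mul, mul_smul, algebraMap_smul_comm c, hm]
    exact M.smul_mem _ (M.smul_mem _ m.2)
  | sup N N' _ _ hN hN' =>
    obtain ⟨n, hn⟩ := hN
    obtain ⟨n', hn'⟩ := hN'
    refine ⟨n + n', fun x hx => ?_⟩
    obtain ⟨y, hy, z, hz, rfl⟩ := Submodule.mem_sup.1 hx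
    rw [smul_add]
    refine M.add_mem ?_ ?_
    · rw [pow_add, mul_comm, map_mul, mul_smul]
      exact M.smul_mem _ (hn y hy)
    · rw [pow_add, map_mul, mul_smul]
      exact M.smul_mem _ (hn' z hz)

include F in
/-- All lattices in `V` have the same reduction in `G₀`. -/
theorem G0.mk_red_eq_of_isLattice [Module.Finite O R] {V M N : Type w} [AddCommGroup V]
    [Module A V] [AddCommGroup M] [Module R M] [Module.Finite R M] [AddCommGroup N] [Module R N]
    [Module.Finite R N] {j : M →ₗ[R] V} (hj : IsLattice R j) {k : N →ₗ[R] V}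
    (hk : IsLattice R k) :
    G0.mk (RBar O R) (Red O (R := R) M) = G0.mk (RBar O R) (Red O (R := R) N) := by
  obtain ⟨ϖ, hϖ⟩ := IsDiscreteValuationRing.exists_irreducible O
  rw [G0.mk_congr (Red.congr O (LinearEquiv.ofInjective j hj.injective)),
    G0.mk_congr (Red.congr O (LinearEquiv.ofInjective k hk.injective))]
  let S := LinearMap.range j ⊔ LinearMap.range k
  have hjS : (LinearMap.range j).FG := Module.Finite.iff_fg.1 inferInstance
  have hkS : (LinearMap.range k).FG := Module.Finite.iff_fg.1 inferInstance
  have : Module.Finite R S := Module.Finite.iff_fg.2 (hjS.sup hkS)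
  have hV : ∀ v : V, algebraMap O R ϖ • v = 0 → v = 0 := fun v hv =>
    smul_left_cancel_of_ne_zero F (R := R) hϖ.ne_zero (by rw [hv, smul_zero])
  obtain ⟨n, hn⟩ := hj.subtype_range.exists_pow_smul_mem hϖ (hjS.sup hkS)
  obtain ⟨n', hn'⟩ := hk.subtype_range.exists_pow_smul_mem hϖ (hjS.sup hkS)
  rw [G0.mk_red_eq_of_le hϖ hV n S _ le_sup_left hn,
    G0.mk_red_eq_of_le hϖ hV n' S _ le_sup_right hn']

variable (hR : Submodule.span F (R : Set A) = ⊤)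

include hR

omit [IsDiscreteValuationRing O] in
/-- Every finitely generated `A`-module contains a finitely generated full lattice. -/
theorem exists_lattice (V : Type*) [AddCommGroup V] [Module A V] [Module.Finite A V] :
    ∃ M : Submodule R V, M.FG ∧ IsLattice R M.subtype := by
  obtain ⟨s, hs⟩ := Module.Finite.fg_top (R := A) (M := V)
  refine ⟨Submodule.span R s, ⟨s, rfl⟩, Submodule.subtype_injective _, fun v => ?_⟩
  suffices h : ∃ c : O, c ≠ 0 ∧ algebraMap O R c • v ∈ Submodule.span R (s : Set V) by
    obtain ⟨c, hc, h⟩ := h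
    exact ⟨c, hc, ⟨_, h⟩, rfl⟩
  have hv : v ∈ Submodule.span A (s : Set V) := hs ▸ Submodule.mem_top
  induction hv using Submodule.span_induction with
  | mem x hx => exact ⟨1, one_ne_zero, by simpa using Submodule.subset_span hx⟩
  | zero => exact ⟨1, one_ne_zero, by simp⟩
  | add x y _ _ hx hy =>
    obtain ⟨c, hc, hx⟩ := hx
    obtain ⟨d, hd, hy⟩ := hy
    refine ⟨c * d, mul_ne_zero hc hd, ?_⟩
    rw [smul_add]
    refine Submodule.add_mem _ ?_ ?_
    · rw [mul_comm, map_mul, mul_smul]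
      exact Submodule.smul_mem _ _ hx
    · rw [map_mul, mul_smul]
      exact Submodule.smul_mem _ _ hy
  | smul a x _ hx =>
    obtain ⟨c, hc, hx⟩ := hx
    obtain ⟨d, hd, r, hr⟩ := exists_smul_mem_order F hR a
    refine ⟨c * d, mul_ne_zero hc hd, ?_⟩
    rw [map_mul, mul_smul, algebraMap_smul_smul hr, algebraMap_smul_comm]
    exact Submodule.smul_mem _ _ hx

theorem exists_decompositionMap [Module.Finite O R] :
    ∃ d : G0 A →+ G0 (RBar O R), ∀ (V M : Type w) [AddCommGroup V] [Module A V]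
      [Module.Finite A V] [AddCommGroup M] [Module R M] [Module.Finite R M] (j : M →ₗ[R] V),
      IsLattice R j → d (G0.mk A V) = G0.mk (RBar O R) (Red O (R := R) M) := by
  obtain ⟨ϖ, hϖ⟩ := IsDiscreteValuationRing.exists_irreducible O
  have : IsNoetherianRing R := IsNoetherianRing.of_finite O R
  choose lat hfg hlat using fun V : FGMod A => exists_lattice F hR V.carrier
  have hfin : ∀ V, Module.Finite R (lat V) := fun V => Module.Finite.iff_fg.2 (hfg V)
  let d : G0 A →+ G0 (RBar O R) := G0.lift
      -- The lattice is an arbitrary choice. For additivity, the chosen lattices of the outer terms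
      -- are replaced by the preimage `L` and the image `N` of the one in the middle.
      (fun V => G0.mk (RBar O R) (Red O (R := R) (lat V))) <| by
    intro U V W f g hf hfg hg
    let fR : U.carrier →ₗ[R] V.carrier := f.restrictScalars R
    let gR : V.carrier →ₗ[R] W.carrier := g.restrictScalars R
    let L := (lat V).comap fR
    let N := (lat V).map gR
    let f' : L →ₗ[R] lat V := fR.restrict fun _ hx => hx
    let g' : lat V →ₗ[R] N := gR.restrict fun x hx => Submodule.mem_map_of_mem hx
    have hf' : Function.Injective f' := fun x y h => Subtype.ext (hf (congrArg Subtype.val h))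
    have hg' : Function.Surjective g' := by
      rintro ⟨_, x, hx, rfl⟩
      exact ⟨⟨x, hx⟩, rfl⟩
    have hgf' : ∀ x, g' (f' x) = 0 := fun x => Subtype.ext (hfg.apply_apply_eq_zero x.1)
    have hex' : ∀ y, g' y = 0 → ∃ x, f' x = y := by
      intro y hy
      obtain ⟨x, hx⟩ := (hfg _).1 (congrArg Subtype.val hy)
      exact ⟨⟨x, show f x ∈ lat V from hx ▸ y.2⟩, Subtype.ext hx⟩
    have : Module.Finite R L := Module.Finite.of_injective f' hf'
    have : Module.Finite R N := Module.Finite.of_surjective g' hg'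
    have hL : IsLattice R L.subtype := by
      refine ⟨Submodule.subtype_injective _, fun v => ?_⟩
      obtain ⟨c, hc, m, hm⟩ := (hlat V).full (f v)
      refine ⟨c, hc, ⟨algebraMap O R c • v, ?_⟩, rfl⟩
      rw [Submodule.mem_comap, map_smul]
      exact hm ▸ m.2
    have hN : IsLattice R N.subtype := by
      refine ⟨Submodule.subtype_injective _, fun w => ?_⟩
      obtain ⟨v, rfl⟩ := hg w
      obtain ⟨c, hc, m, hm⟩ := (hlat V).full v
      refine ⟨c, hc, ⟨algebraMap O R c • g v, ?_⟩, rfl⟩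
      exact ⟨m, m.2, by rw [← Submodule.subtype_apply, ← hm, map_smul]; rfl⟩
    change G0.mk (RBar O R) (Red O (R := R) (lat V)) = G0.mk (RBar O R) (Red O (R := R) (lat U)) +
      G0.mk (RBar O R) (Red O (R := R) (lat W))
    rw [G0.mk_red_eq_of_isLattice F (hlat U) hL, G0.mk_red_eq_of_isLattice F (hlat W) hN]
    refine G0.mk_exact (Red.map O f') (Red.map O g') ?_ ?_ ?_
    · rw [injective_iff_map_eq_zero]
      intro x hx
      obtain ⟨x, rfl⟩ := Red.mk_surjective O x
      rw [Red.map_mk, Red.mk_eq_zero_iff hϖ] at hx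
      obtain ⟨y, hy⟩ := hx
      -- Here `f' x = ϖ y`, so `ϖ g'(y) = 0`. Absence of torsion in `N` is what keeps the reduced
      -- sequence exact on the left.
      have hgy : g' y = 0 := by
        refine Subtype.ext (smul_left_cancel_of_ne_zero F (R := R) hϖ.ne_zero ?_)
        have h2 : algebraMap O R ϖ • g' y = 0 := by rw [← map_smul, ← hy, hgf']
        rw [← Submodule.coe_smul, h2]
        simp
      obtain ⟨z, rfl⟩ := hex' y hgy
      rw [Red.mk_eq_zero_iff hϖ]
      exact ⟨z, hf' (by rw [hy, map_smul])⟩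
    · intro y
      obtain ⟨y, rfl⟩ := Red.mk_surjective O y
      constructor
      · intro hy
        rw [Red.map_mk, Red.mk_eq_zero_iff hϖ] at hy
        obtain ⟨n, hn⟩ := hy
        obtain ⟨z, rfl⟩ := hg' n
        -- Subtracting `ϖ z` leaves the reduction of `y` unchanged and moves `y` into the kernel of
        -- `g'`.
        obtain ⟨x, hx⟩ := hex' (y - algebraMap O R ϖ • z) (by rw [map_sub, hn, map_smul, sub_self])
        refine ⟨Red.mk O L x, ?_⟩
        rw [Red.map_mk, hx, eq_comm, Red.mk_eq_iff hϖ]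
        exact ⟨z, by abel⟩
      · rintro ⟨x, hx⟩
        obtain ⟨x, rfl⟩ := Red.mk_surjective O x
        rw [← hx, Red.map_mk, Red.map_mk, hgf', map_zero]
    · intro y
      obtain ⟨y, rfl⟩ := Red.mk_surjective O y
      obtain ⟨x, rfl⟩ := hg' y
      exact ⟨Red.mk O _ x, rfl⟩
  refine ⟨d, fun V M _ _ _ _ _ _ j hj => ?_⟩
  rw [show d (G0.mk A V) = _ from G0.lift_mk _ _ V]
  exact G0.mk_red_eq_of_isLattice F (hlat ⟨V⟩) hj

end Decomposition

/-! ### The extension map -/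

section Extension

variable {O : Type u} [CommRing O] [IsDomain O] (F : Type v) [Field F]
  [Algebra O F] [IsFractionRing O F] {A : Type w} [Ring A] [Algebra F A] [Algebra O A]
  [IsScalarTower O F A] {R : Subalgebra O A}

theorem IsLattice.prodMap {M M' V V' : Type*} [AddCommGroup M] [Module R M] [AddCommGroup M']
    [Module R M'] [AddCommGroup V] [Module A V] [AddCommGroup V'] [Module A V']
    {j : M →ₗ[R] V} {j' : M' →ₗ[R] V'} (hj : IsLattice R j) (hj' : IsLattice R j')
    (k : M × M' →ₗ[R] V × V') (hk : ∀ x, k x = (j x.1, j' x.2)) :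
    IsLattice R k := by
  refine ⟨fun x y h => ?_, fun v => ?_⟩
  · rw [hk, hk, Prod.mk.injEq] at h
    exact Prod.ext (hj.injective h.1) (hj'.injective h.2)
  · obtain ⟨c, hc, m, hm⟩ := hj.full v.1
    obtain ⟨c', hc', m', hm'⟩ := hj'.full v.2
    refine ⟨c * c', mul_ne_zero hc hc', (algebraMap O R c' • m, algebraMap O R c • m'), ?_⟩
    rw [hk, map_smul, map_smul, ← hm, ← hm', ← mul_smul, ← mul_smul, ← map_mul, ← map_mul,
      mul_comm c' c]
    rfl

/-- The direct product of two homomorphisms from `R`-modules to `A`-modules. -/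
def prodMapRestrict {M M' V V' : Type*} [AddCommGroup M] [Module R M] [AddCommGroup M']
    [Module R M'] [AddCommGroup V] [Module A V] [AddCommGroup V'] [Module A V']
    (j : M →ₗ[R] V) (j' : M' →ₗ[R] V') : M × M' →ₗ[R] V × V' where
  toFun x := (j x.1, j' x.2)
  map_add' x y := by simp
  map_smul' r x := by simp

variable (hR : Submodule.span F (R : Set A) = ⊤)

include hR

theorem exists_pi_lattice (n : ℕ) : ∃ ι : (Fin n → R) →ₗ[R] (Fin n → A), IsLattice R ι := by
  refine ⟨{ toFun := fun x i => x i, map_add' := fun _ _ => rfl, map_smul' := fun _ _ => rfl },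
    fun x y h => funext fun i => Subtype.ext (congrFun h i), fun v => ?_⟩
  choose c hc r hr using fun i => exists_smul_mem_order F hR (v i)
  refine ⟨∏ i, c i, Finset.prod_ne_zero_iff.2 fun i _ => hc i,
    fun i => algebraMap O R (∏ k ∈ Finset.univ.erase i, c k) * r i, funext fun i => ?_⟩
  change algebraMap O A (∏ i, c i) * v i =
    algebraMap O A (∏ k ∈ Finset.univ.erase i, c k) * (r i : A)
  rw [← hr, ← mul_assoc, ← map_mul, Finset.prod_erase_mul _ _ (Finset.mem_univ i)]

/-- A finitely generated projective `R`-module is a lattice in a finitely generated projective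
`A`-module. -/
theorem exists_projective_extension (P : Type w) [AddCommGroup P] [Module R P]
    [Module.Finite R P] [Module.Projective R P] :
    ∃ (V : FGProj A) (j : P →ₗ[R] V.carrier), IsLattice R j := by
  obtain ⟨n, q, hq⟩ := Module.Finite.exists_fin' R P
  obtain ⟨s, hs⟩ := Module.projective_lifting_property q LinearMap.id hq
  have hqs : ∀ y, q (s y) = y := LinearMap.congr_fun hs
  obtain ⟨ι, hι⟩ := exists_pi_lattice F hR n
  -- `P` is the image of the idempotent `s ∘ q` of `Rⁿ`; its extension `ε` to `Aⁿ` is idempotent,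
  -- and its image is the required module.
  obtain ⟨ε, hε⟩ := hι.exists_extend F hR (ι ∘ₗ s ∘ₗ q)
  have hεε : ∀ v, ε (ε v) = ε v := by
    have : ε ∘ₗ ε = ε := hι.hom_ext F fun m => by simp [hε, hqs]
    exact LinearMap.congr_fun this
  have : Module.Projective A (LinearMap.range ε) :=
    Module.Projective.of_split (LinearMap.range ε).subtype ε.rangeRestrict <| by
      ext ⟨_, v, rfl⟩ : 2
      exact hεε v
  refine ⟨⟨LinearMap.range ε⟩,
    { toFun := fun x => ⟨ι (s x), ι (s x), by simp [hε, hqs]⟩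
      map_add' := fun x y => Subtype.ext (by simp)
      map_smul' := fun r x => Subtype.ext (by simp) }, fun x y h => ?_, ?_⟩
  · have := hι.injective (congrArg Subtype.val h)
    rw [← hqs x, this, hqs]
  · rintro ⟨_, v, rfl⟩
    obtain ⟨c, hc, m, hm⟩ := hι.full v
    refine ⟨c, hc, q m, Subtype.ext ?_⟩
    change algebraMap O A c • ε v = ι (s (q m))
    rw [← map_smul]
    exact (congrArg ε hm).trans (hε m)

end Extension

section ExtensionMap

variable {O : Type u} [CommRing O] [IsDomain O] [IsDiscreteValuationRing O]
  [IsAdicComplete (maximalIdeal O) O] (F : Type v) [Field F]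
  [Algebra O F] [IsFractionRing O F] {A : Type w} [Ring A] [Algebra F A] [Algebra O A]
  [IsScalarTower O F A] {R : Subalgebra O A}

/-- Reduction commutes with direct products. -/
def Red.prodEquiv (O : Type v) [CommRing O] [IsLocalRing O] {R : Type w} [Ring R] [Algebra O R]
    (M N : Type w) [AddCommGroup M] [Module R M] [AddCommGroup N] [Module R N] :
    Red O (R := R) (M × N) ≃ₗ[RBar O R] Red O (R := R) M × Red O (R := R) N :=
  LinearEquiv.ofLinearMap
    ((Red.map O (LinearMap.fst R M N)).prod (Red.map O (LinearMap.snd R M N)))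
    ((Red.map O (LinearMap.inl R M N)).coprod (Red.map O (LinearMap.inr R M N)))
    (by
      refine LinearMap.ext fun ⟨x, y⟩ => ?_
      obtain ⟨x, rfl⟩ := Red.mk_surjective O x
      obtain ⟨y, rfl⟩ := Red.mk_surjective O y
      simp)
    (Red.hom_ext O fun x => by simp [← map_add])

theorem exists_extensionMap [Module.Finite O R] [Module.Free O R]
    (hR : Submodule.span F (R : Set A) = ⊤) :
    ∃ e : K0 (RBar O R) →+ K0 A, ∀ (P V : Type w) [AddCommGroup P] [Module R P]
      [Module.Finite R P] [Module.Projective R P] [AddCommGroup V] [Module A V]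
      [Module.Finite A V] [Module.Projective A V] (j : P →ₗ[R] V), IsLattice R j →
      e (K0.mk (RBar O R) (Red O (R := R) P)) = K0.mk A V := by
  choose L φ using fun Q : FGProj (RBar O R) => exists_projective_lift (O := O) (R := R) Q
  choose X j hj using fun Q => exists_projective_extension F hR (L Q).carrier
  -- The extension depends on `Q` alone: lifts of `Q` are isomorphic, and so are modules containing
  -- the same lattice. This gives both additivity and the formula for `e`.
  have huniq : ∀ (Q : FGProj (RBar O R)) (P V : Type w) [AddCommGroup P] [Module R P]
      [Module.Finite R P] [Module.Projective R P] [AddCommGroup V] [Module A V]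
      [Module.Finite A V] [Module.Projective A V] (i : P →ₗ[R] V), IsLattice R i →
      Nonempty (Red O (R := R) P ≃ₗ[RBar O R] Q.carrier) →
      Nonempty ((X Q).carrier ≃ₗ[A] V) := by
    intro Q P V _ _ _ _ _ _ _ _ i hi ⟨ψ⟩
    obtain ⟨φ⟩ := φ Q
    obtain ⟨χ⟩ := nonempty_equiv_of_red_equiv (φ.trans ψ.symm)
    refine IsLattice.nonempty_equiv F hR (hj Q) (j' := i ∘ₗ χ.toLinearMap)
      ⟨hi.injective.comp χ.injective, fun v => ?_⟩
    obtain ⟨c, hc, m, hm⟩ := hi.full v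
    exact ⟨c, hc, χ.symm m, by simp [hm]⟩
  let e : K0 (RBar O R) →+ K0 A := K0.lift (fun Q => K0.mk A (X Q).carrier) <| by
    rintro Q Q₁ Q₂ ⟨ψ⟩
    obtain ⟨φ₁⟩ := φ Q₁
    obtain ⟨φ₂⟩ := φ Q₂
    obtain ⟨χ⟩ := huniq Q ((L Q₁).carrier × (L Q₂).carrier) _ _
      ((hj Q₁).prodMap (hj Q₂) (prodMapRestrict (j Q₁) (j Q₂)) fun _ => rfl)
      ⟨(Red.prodEquiv O _ _).trans ((φ₁.prodCongr φ₂).trans ψ.symm)⟩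
    exact K0.mk_prod χ
  refine ⟨e, fun P V _ _ _ _ _ _ _ _ i hi => ?_⟩
  rw [show e (K0.mk (RBar O R) (Red O (R := R) P)) = _ from K0.lift_mk _ _ _]
  obtain ⟨χ⟩ := huniq ⟨Red O (R := R) P⟩ P V i hi ⟨LinearEquiv.refl _ _⟩
  exact K0.mk_congr χ

end ExtensionMap

/-! ### Adjointness -/

section Adjoint

variable {O : Type u} [CommRing O] [IsDomain O] [IsDiscreteValuationRing O] (F : Type v) [Field F]
  [Algebra O F] [IsFractionRing O F] {A : Type w} [Ring A] [Algebra F A] [Algebra O A]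
  [IsScalarTower O F A] {R : Subalgebra O A}

-- Over a discrete valuation ring this makes finitely generated lattices free, as the definition of
-- an `R`-form demands.
include F in
omit [IsDiscreteValuationRing O] in
theorem IsLattice.isTorsionFree {M V : Type*} [AddCommGroup M] [Module R M] [Module O M]
    [IsScalarTower O R M] [AddCommGroup V] [Module A V] {j : M →ₗ[R] V} (hj : IsLattice R j) :
    Module.IsTorsionFree O M := by
  refine Module.IsTorsionFree.mk fun c hc x y h => hj.injective ?_
  refine smul_left_cancel_of_ne_zero F (R := R) hc.ne_zero ?_
  rw [← map_smul, ← map_smul, algebraMap_smul, algebraMap_smul]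
  exact congrArg j h

/-- The rank of `Hom_R(P, M)` is the dimension of `Hom_A(U, V)`, for lattices `P`, `M` in the
`A`-modules `U`, `V`. -/
theorem finrank_hom_eq_of_isLattice (hR : Submodule.span F (R : Set A) = ⊤) {P M U V : Type w}
    [AddCommGroup P] [Module R P] [Module.Finite R P] [AddCommGroup M] [Module R M]
    [Module O M] [IsScalarTower O R M] [AddCommGroup U] [Module A U] [AddCommGroup V] [Module A V]
    [Module F V] [IsScalarTower F A V] {i : P →ₗ[R] U} (hi : IsLattice R i) {j : M →ₗ[R] V}
    (hj : IsLattice R j) : Module.finrank F (U →ₗ[A] V) = Module.finrank O (P →ₗ[R] M) := by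
  obtain ⟨ϖ, hϖ⟩ := IsDiscreteValuationRing.exists_irreducible O
  let : Module O V := Module.compHom V (algebraMap O A)
  have : IsScalarTower O A V := ⟨fun c a m => by rw [Algebra.smul_def, mul_smul]; rfl⟩
  have : IsScalarTower O F V := ⟨fun c a m => by
    rw [← algebraMap_smul A (c • a) m, ← algebraMap_smul A a m,
      ← algebraMap_smul A c (algebraMap F A a • m),
      ← mul_smul, Algebra.smul_def, map_mul, ← IsScalarTower.algebraMap_apply]⟩
  have hsmul : ∀ (c : O) (v : V), c • v = algebraMap O R c • v := fun _ _ => rfl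
  choose Λ hΛ using fun h : P →ₗ[R] M => hi.exists_extend F hR (j ∘ₗ h)
  let ΛO : (P →ₗ[R] M) →ₗ[O] (U →ₗ[A] V) :=
    { toFun := Λ
      map_add' := fun h h' => hi.hom_ext F fun x => by simp [hΛ]
      map_smul' := fun c h => hi.hom_ext F fun x => by
        rw [hΛ, RingHom.id_apply, LinearMap.smul_apply, hΛ, LinearMap.comp_apply,
          LinearMap.smul_apply, ← algebraMap_smul R c (h x), map_smul, hsmul]
        rfl }
  -- Extension of maps exhibits `Hom_A(U, V)` as the localization of `Hom_R(P, M)`, so dimension and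
  -- rank agree. For surjectivity up to denominators, `g` carries `P` to a finitely generated
  -- submodule, which some power of `ϖ` moves into `M`.
  have hloc : IsLocalizedModule (nonZeroDivisors O) ΛO := by
    refine ⟨fun c => ?_, fun g => ?_, fun {h h'} hh => ⟨1, ?_⟩⟩
    · have hc : (c : O) ≠ 0 := nonZeroDivisors.ne_zero c.2
      rw [Module.End.isUnit_iff]
      refine ⟨fun g g' h => LinearMap.ext fun x => ?_, fun g => ?_⟩
      · exact smul_left_cancel_of_ne_zero F (R := R) hc (LinearMap.congr_fun h x)
      · refine ⟨(algebraMap O F c)⁻¹ • g, ?_⟩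
        change (c : O) • (algebraMap O F c)⁻¹ • g = g
        rw [← algebraMap_smul F (c : O), smul_inv_smul₀]
        exact (map_ne_zero_iff _ (IsFractionRing.injective O F)).2 hc
    · let gR : P →ₗ[R] V := g.restrictScalars R ∘ₗ i
      obtain ⟨n, hn⟩ := hj.subtype_range.exists_pow_smul_mem hϖ
        (N := LinearMap.range gR) (Module.Finite.iff_fg.1 inferInstance)
      let h : P →ₗ[R] M := (LinearEquiv.ofInjective j hj.injective).symm.toLinearMap ∘ₗ
        (scalarMul R V (ϖ ^ n) ∘ₗ gR).codRestrict (LinearMap.range j)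
          fun x => hn _ (LinearMap.mem_range_self gR x)
      have hh : ∀ x, j (h x) = algebraMap O R (ϖ ^ n) • g (i x) := fun x =>
        congrArg Subtype.val ((LinearEquiv.ofInjective j hj.injective).apply_symm_apply
          ⟨_, hn _ (LinearMap.mem_range_self gR x)⟩)
      refine ⟨⟨h, ⟨ϖ ^ n, mem_nonZeroDivisors_of_ne_zero (pow_ne_zero n hϖ.ne_zero)⟩⟩,
        hi.hom_ext F fun x => ?_⟩
      change (ϖ ^ n) • g (i x) = Λ h (i x)
      rw [hΛ, LinearMap.comp_apply, hh, hsmul]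
    · rw [one_smul, one_smul]
      refine LinearMap.ext fun x => hj.injective ?_
      have := LinearMap.congr_fun hh (i x)
      exact (hΛ h x).symm.trans (this.trans (hΛ h' x))
  rw [IsLocalization.finrank_eq F (nonZeroDivisors O) le_rfl,
    IsLocalizedModule.finrank_eq (nonZeroDivisors O) ΛO le_rfl]

-- Precomposition with a surjection `Rⁿ → P` embeds the Hom module in `Mⁿ`, which is noetherian over
-- `O`.
omit [IsDomain O] [IsDiscreteValuationRing O] in
theorem finite_hom_order [IsNoetherianRing O] [Module.Finite O R] {P M : Type*} [AddCommGroup P]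
    [Module R P] [Module.Finite R P] [AddCommGroup M] [Module R M] [Module.Finite R M] [Module O M]
    [IsScalarTower O R M] : Module.Finite O (P →ₗ[R] M) := by
  have : Module.Finite O M := Module.Finite.trans R M
  obtain ⟨n, q, hq⟩ := Module.Finite.exists_fin' R P
  let f : (P →ₗ[R] M) →ₗ[O] ((Fin n → R) →ₗ[R] M) := LinearMap.lcomp O M q
  let g : ((Fin n → R) →ₗ[R] M) ≃ₗ[O] (Fin n → M) := ((Pi.basisFun R (Fin n)).constr O).symm
  refine Module.Finite.of_injective (g.toLinearMap ∘ₗ f) (g.injective.comp fun h h' e => ?_)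
  exact LinearMap.cancel_right hq |>.1 e

/-- The rank of `Hom_R(P, M)` is the dimension of `Hom_R̄(P / 𝔪P, M / 𝔪M)`, for `P` projective and
`M` without torsion. -/
theorem finrank_hom_red [Module.Finite O R] {P M : Type w} [AddCommGroup P]
    [Module R P] [Module.Finite R P] [Module.Projective R P] [AddCommGroup M] [Module R M]
    [Module.Finite R M] [Module O M] [IsScalarTower O R M] [Module.IsTorsionFree O M]
    [Module (ResidueField O) (Red O (R := R) M)]
    [IsScalarTower (ResidueField O) (RBar O R) (Red O (R := R) M)] :
    Module.finrank (ResidueField O) (Red O (R := R) P →ₗ[RBar O R] Red O (R := R) M) =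
      Module.finrank O (P →ₗ[R] M) := by
  obtain ⟨ϖ, hϖ⟩ := IsDiscreteValuationRing.exists_irreducible O
  have : Module.Finite O (P →ₗ[R] M) := finite_hom_order
  have : Module.IsTorsionFree O (P →ₗ[R] M) := Module.IsTorsionFree.mk fun c hc h h' e =>
    LinearMap.ext fun x => hc.isSMulRegular (M := M) (LinearMap.congr_fun e x)
  have : Module.Free O (P →ₗ[R] M) := Module.free_of_finite_type_torsion_free'
  let Ψ : (P →ₗ[R] M) →ₛₗ[residue O] (Red O (R := R) P →ₗ[RBar O R] Red O (R := R) M) :=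
    { toFun := Red.map O
      map_add' := fun h h' => Red.hom_ext O fun x => by simp
      map_smul' := fun c h => Red.hom_ext O fun x => by
        rw [Red.map_mk, LinearMap.smul_apply, LinearMap.smul_apply, Red.map_mk,
          ← algebraMap_smul (RBar O R) (residue O c), ← algebraMap_smul R c, map_smulₛₗ]
        rfl }
  have hΨ : Function.Surjective Ψ := Red.exists_lift O
  -- A map with values in `ϖM` can be divided by `ϖ`, as `M` has no torsion. Thus `Ψ` is reduction
  -- of the free module `Hom_R(P, M)` modulo `ϖ`, and it carries an `O`-basis to a basis over the
  -- residue field.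
  have hker : ∀ h, Ψ h = 0 → ∃ h', h = ϖ • h' := by
    intro h hh
    have hinj : Function.Injective (scalarMul R M ϖ) := fun x y e => by
      rw [scalarMul_apply, scalarMul_apply, algebraMap_smul, algebraMap_smul] at e
      exact smul_right_injective M hϖ.ne_zero e
    have hmem : ∀ x, h x ∈ LinearMap.range (scalarMul R M ϖ) := by
      intro x
      obtain ⟨y, hy⟩ := (Red.mk_eq_zero_iff hϖ).1 (LinearMap.congr_fun hh (Red.mk O P x))
      exact ⟨y, hy.symm⟩
    refine ⟨(LinearEquiv.ofInjective _ hinj).symm.toLinearMap ∘ₗ h.codRestrict _ hmem,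
      LinearMap.ext fun x => ?_⟩
    have := congrArg Subtype.val
      ((LinearEquiv.ofInjective _ hinj).apply_symm_apply (h.codRestrict _ hmem x))
    rw [LinearMap.smul_apply, ← algebraMap_smul R ϖ]
    exact this.symm
  let b := Module.Free.chooseBasis O (P →ₗ[R] M)
  have hli : LinearIndependent (ResidueField O) (Ψ ∘ b) := by
    rw [Fintype.linearIndependent_iff]
    intro c hc i
    choose c' hc' using fun i => residue_surjective (R := O) (c i)
    have h0 : Ψ (∑ i, c' i • b i) = 0 := by
      rw [map_sum, ← hc]
      exact Finset.sum_congr rfl fun i _ => by rw [map_smulₛₗ, hc']; rfl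
    obtain ⟨h', hh'⟩ := hker _ h0
    have : c' i = ϖ * b.repr h' i := by
      rw [← Module.Basis.repr_sum_self b c', hh']
      simp
    rw [← hc', this, residue_eq_zero_iff]
    exact Ideal.mul_mem_right _ _ ((mem_maximalIdeal _).2 hϖ.not_isUnit)
  have hsp : ⊤ ≤ Submodule.span (ResidueField O) (Set.range (Ψ ∘ b)) := by
    intro g _
    obtain ⟨h, rfl⟩ := hΨ g
    rw [← b.sum_repr h, map_sum]
    refine Submodule.sum_mem _ fun i _ => ?_
    rw [map_smulₛₗ]
    exact Submodule.smul_mem _ _ (Submodule.subset_span ⟨i, rfl⟩)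
  rw [Module.finrank_eq_card_basis (Module.Basis.mk hli hsp), Module.finrank_eq_card_basis b]

theorem pairing_eq_of_isLattice [Module.Finite F A] [Module.Finite O R]
    (hR : Submodule.span F (R : Set A) = ⊤) {P M U V : Type w}
    [AddCommGroup P] [Module R P] [Module.Finite R P] [Module.Projective R P] [AddCommGroup M]
    [Module R M] [Module.Finite R M] [AddCommGroup U] [Module A U] [Module.Finite A U]
    [Module.Projective A U] [AddCommGroup V] [Module A V] [Module.Finite A V]
    {i : P →ₗ[R] U} (hi : IsLattice R i) {j : M →ₗ[R] V} (hj : IsLattice R j) :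
    pairing F A (K0.mk A U) (G0.mk A V) =
      pairing (ResidueField O) (RBar O R) (K0.mk (RBar O R) (Red O (R := R) P))
        (G0.mk (RBar O R) (Red O (R := R) M)) := by
  let : Module F V := Module.compHom V (algebraMap F A)
  have : IsScalarTower F A V := ⟨fun c a m => by rw [Algebra.smul_def, mul_smul]; rfl⟩
  let : Module O M := Module.compHom M (algebraMap O R)
  have : IsScalarTower O R M := ⟨fun c a m => by rw [Algebra.smul_def, mul_smul]; rfl⟩
  let : Module (ResidueField O) (Red O (R := R) M) :=
    Module.compHom _ (algebraMap (ResidueField O) (RBar O R))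
  have : IsScalarTower (ResidueField O) (RBar O R) (Red O (R := R) M) :=
    ⟨fun c a m => by rw [Algebra.smul_def, mul_smul]; rfl⟩
  have : Module.IsTorsionFree O M := hj.isTorsionFree F
  rw [pairing_mk, pairing_mk, finrank_hom_eq_of_isLattice F hR hi hj, finrank_hom_red]

end Adjoint

end BrauerSquare

/-! ### The Brauer square -/

theorem theoremt {O : Type*} [CommRing O] [IsDomain O] [IsDiscreteValuationRing O]
    [IsAdicComplete (maximalIdeal O) O] {F : Type*} [Field F] [Algebra O F] [IsFractionRing O F]
    {A : Type*} [Ring A] [Algebra F A] [Algebra O A] [IsScalarTower O F A] [Module.Finite F A]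
    (R : Subalgebra O A) [Module.Finite O R] [Module.Free O R]
    (hR : Submodule.span F (R : Set A) = ⊤) :
    ∃ (e : K0 (RBar O R) →+ K0 A) (d : G0 A →+ G0 (RBar O R)),
      (IsExtensionMap F R e ∧ ∀ e', IsExtensionMap F R e' → e' = e) ∧
      (IsDecompositionMap F R d ∧ ∀ d', IsDecompositionMap F R d' → d' = d) ∧
      d.comp ((cartan A).comp e) = cartan (RBar O R) ∧
      (IsSplittingFieldFor F A → IsSplittingFieldFor (ResidueField O) (RBar O R) →
        (pairing F A).IsPerfPair ∧ (pairing (ResidueField O) (RBar O R)).IsPerfPair ∧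
        ∀ (x : K0 (RBar O R)) (y : G0 A),
          pairing F A (e x) y = pairing (ResidueField O) (RBar O R) x (d y)) := by
  obtain ⟨e, he⟩ := exists_extensionMap F hR
  obtain ⟨d, hd⟩ := exists_decompositionMap F hR
  refine ⟨e, d, ⟨?_, fun e' he' => K0.hom_ext fun Q => ?_⟩,
    ⟨?_, fun d' hd' => G0.hom_ext fun V => ?_⟩, K0.hom_ext fun Q => ?_, fun hF hk =>
    ⟨pairing_isPerfPair F A hF, pairing_isPerfPair _ _ hk, fun x y => ?_⟩⟩
  · intro P _ _ _ _ _ _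
    obtain ⟨V, j, hj⟩ := exists_projective_extension F hR P
    exact ⟨V, hj.isScalarExtension, he P V.carrier j hj⟩
  · obtain ⟨P, ⟨φ⟩⟩ := exists_projective_lift (O := O) (R := R) Q
    let : Module O P.carrier := Module.compHom _ (algebraMap O R)
    have : IsScalarTower O R P.carrier :=
      ⟨fun c a m => by rw [Algebra.smul_def, mul_smul]; rfl⟩
    have : Module.Finite O P.carrier := Module.Finite.trans R _
    obtain ⟨W, i, hi⟩ := exists_projective_extension F hR P.carrier
    have : Module.IsTorsionFree O P.carrier := hi.isTorsionFree F
    -- Freeness is needed to turn the abstract isomorphism `F ⊗ P ≅ V` supplied by `e'` into a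
    -- lattice inclusion.
    have : Module.Free O P.carrier := Module.free_of_finite_type_torsion_free'
    obtain ⟨V, hV, h⟩ := he' P.carrier
    obtain ⟨j, hj⟩ := hV.exists_isLattice
    rw [← K0.mk_congr φ, h, he _ _ j hj]
  · intro V _ _ _ M _ _ _ _ _ hM
    have := hM.free
    obtain ⟨j, hj⟩ := hM.ext.exists_isLattice
    exact hd V M j hj
  · obtain ⟨M, hM, hlat⟩ := exists_lattice F hR V.carrier
    have : Module.Finite R M := Module.Finite.iff_fg.2 hM
    let : Module O M := Module.compHom _ (algebraMap O R)
    have : IsScalarTower O R M := ⟨fun c a m => by rw [Algebra.smul_def, mul_smul]; rfl⟩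
    have : Module.Finite O M := Module.Finite.trans R _
    have : Module.IsTorsionFree O M := hlat.isTorsionFree F
    rw [hd _ M _ hlat]
    exact hd' V.carrier M
      ⟨inferInstance, Module.free_of_finite_type_torsion_free', hlat.isScalarExtension⟩
  · obtain ⟨P, ⟨φ⟩⟩ := exists_projective_lift (O := O) (R := R) Q
    obtain ⟨V, j, hj⟩ := exists_projective_extension F hR P.carrier
    rw [← K0.mk_congr φ, AddMonoidHom.comp_apply, AddMonoidHom.comp_apply, he _ _ j hj, cartan_mk,
      cartan_mk, hd _ _ j hj]
  -- Both sides are biadditive, so it suffices to compare them on the class of a reduced projective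
  -- and the class of a module with a chosen lattice.
  · have key : (((pairing F A).toAddMonoidHom.comp e) : K0 (RBar O R) →+ (G0 A →ₗ[ℤ] ℤ)) =
        ((pairing (ResidueField O) (RBar O R)).compl₂ d.toIntLinearMap).toAddMonoidHom := by
      refine K0.hom_ext fun Q => LinearMap.toAddMonoidHom_injective (G0.hom_ext fun V => ?_)
      obtain ⟨P, ⟨φ⟩⟩ := exists_projective_lift (O := O) (R := R) Q
      obtain ⟨U, i, hi⟩ := exists_projective_extension F hR P.carrier
      obtain ⟨M, hM, hlat⟩ := exists_lattice F hR V.carrier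
      have : Module.Finite R M := Module.Finite.iff_fg.2 hM
      change pairing F A (e (K0.mk _ Q.carrier)) (G0.mk A V.carrier) =
        pairing (ResidueField O) (RBar O R) (K0.mk _ Q.carrier) (d (G0.mk A V.carrier))
      rw [← K0.mk_congr φ, he _ _ i hi, hd _ _ _ hlat]
      exact pairing_eq_of_isLattice F hR hi hlat
    exact LinearMap.congr_fun (DFunLike.congr_fun key x) y
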